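/- Consider the Halpern--Shoham interval logic with the non-strict irreflexive semantics: its formulas are evaluated at the intervals $\langle x,y\rangle$, $x\le y$ (punctual intervals $\langle x,x\rangle$ included), of a linear order $(T,\le)$, and its box operators $[\mathsf R]$ range over the twelve interval relations, defined with the strict order $<$: $\langle x_1,y_1\rangle$ is related to $\langle x_2,y_2\rangle$ by $\mathsf A$ iff $y_1=x_2<y_2$; by $\mathsf B$ iff $x_1=x_2$ and $y_2<y_1$; by $\mathsf E$ iff $x_1<x_2$ and $y_1=y_2$; by $\mathsf D$ iff $x_1<x_2$ and $y_2<y_1$; by $\mathsf L$ iff $y_1<x_2$; by $\mathsf O$ iff $x_1<x_2<y_1<y_2$; by $\bar{\mathsf A}$ iff $y_2=x_1$ and $x_2<y_2$; and by $\bar{\mathsf B},\bar{\mathsf E},\bar{\mathsf D},\bar{\mathsf L},\bar{\mathsf O}$ iff the converse of $\mathsf B,\mathsf E,\mathsf D,\mathsf L,\mathsf O$, respectively, holds. Let $\mathcal{HS}^\Box_{\mathit{core}}$ be the set of finite conjunctions of initial conditions $\lambda$ and clauses of the forms $[\mathsf U](\lambda_1\to\lambda_2)$ and $[\mathsf U](\lambda_1\wedge\lambda_2\to\bot)$,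 where $[\mathsf U]$ quantifies over all intervals and the literals are given by $\lambda::=\top\mid\bot\mid p\mid[\mathsf R]\lambda$, with $p$ a propositional variable and $\mathsf R$ an interval relation. For a class $\mathcal C$ of linear orders, a formula is $\mathcal C(<)$-satisfiable if, under this semantics, it is true at some interval of some model based on an order from $\mathcal C$. A linear order is discrete if every non-maximal element has an immediate successor and every non-minimal element has an immediate predecessor. (i) For every class $\mathsf{Dis}^\infty$ of discrete linear orders that contains an infinite order, $\mathsf{Dis}^\infty(<)$-satisfiability of $\mathcal{HS}^\Box_{\mathit{core}}$-formulas is $\mathrm{PSPACE}$-hard (under polynomial-time many-one reductions). (ii) For the class $\mathsf{Fin}$ of all finite linear orders, $\mathsf{Fin}(<)$-satisfiability of $\mathcal{HS}^\Box_{\mathit{core}}$-formulas is $\mathrm{PSPACE}$-hard (under polynomial-time many-one reductions). -/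

import Mathlib

universe u

namespace HSLogic

/-! ### Syntax of the Horn fragment of the Halpern-Shoham logic -/

/-- The twelve interval relations; `Xi` is the inverse of `X`. -/
inductive IntervalRel : Type
  | A | B | E | D | L | O | Ai | Bi | Ei | Di | Li | Oi

/-- Positive temporal literals. Propositional variables are named by words over `{0,1}`. -/
inductive Literal : Type
  | top : Literal
  | bot : Literal
  | var : List Bool → Literal
  | dia : IntervalRel → Literal → Literal
  | box : IntervalRel → Literal → Literal

/-- Horn formulas: `init l` is the initial condition `l`, `clause [l₁, …, lₖ] l` is
`[U](l₁ ∧ … ∧ lₖ → l)`, and `conj` is conjunction. -/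
inductive Formula : Type
  | init : Literal → Formula
  | clause : List Literal → Literal → Formula
  | conj : Formula → Formula → Formula

/-- The literal has no occurrence of a diamond operator. -/
def Literal.IsBox : Literal → Prop
  | .top => True
  | .bot => True
  | .var _ => True
  | .dia _ _ => False
  | .box _ l => l.IsBox

/-- The formula has no occurrence of a diamond operator. -/
def Formula.IsBox : Formula → Prop
  | .init l => l.IsBox
  | .clause ls l => (∀ l' ∈ ls, l'.IsBox) ∧ l.IsBox
  | .conj φ ψ => φ.IsBox ∧ ψ.IsBox

/-- All clauses have the form `[U](l₁ → l₂)` or `[U](l₁ ∧ l₂ → ⊥)`. -/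
def Formula.IsCore : Formula → Prop
  | .init _ => True
  | .clause ls l => (∃ l₁, ls = [l₁]) ∨ (∃ l₁ l₂, ls = [l₁, l₂] ∧ l = .bot)
  | .conj φ ψ => φ.IsCore ∧ ψ.IsCore

/-! ### Irreflexive semantics -/

/-- The interval relations under the irreflexive semantics. The intervals of a linear order `T`
are the pairs `⟨x, y⟩` with `x ≤ y`, punctual intervals `⟨x, x⟩` included. -/
def IntervalRel.Holds {T : Type u} [LinearOrder T] :
    IntervalRel → NonemptyInterval T → NonemptyInterval T → Prop
  | .A, i, j => i.snd = j.fst ∧ j.fst < j.snd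
  | .B, i, j => i.fst = j.fst ∧ j.snd < i.snd
  | .E, i, j => i.fst < j.fst ∧ i.snd = j.snd
  | .D, i, j => i.fst < j.fst ∧ j.snd < i.snd
  | .L, i, j => i.snd < j.fst
  | .O, i, j => i.fst < j.fst ∧ j.fst < i.snd ∧ i.snd < j.snd
  | .Ai, i, j => j.snd = i.fst ∧ j.fst < j.snd
  | .Bi, i, j => i.fst = j.fst ∧ i.snd < j.snd
  | .Ei, i, j => j.fst < i.fst ∧ i.snd = j.snd
  | .Di, i, j => j.fst < i.fst ∧ i.snd < j.snd
  | .Li, i, j => j.snd < i.fst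
  | .Oi, i, j => j.fst < i.fst ∧ i.fst < j.snd ∧ j.snd < i.snd

/-- Truth of a literal at an interval, under the valuation `ν`. -/
def Literal.Holds {T : Type u} [LinearOrder T] (ν : List Bool → Set (NonemptyInterval T)) :
    Literal → NonemptyInterval T → Prop
  | .top, _ => True
  | .bot, _ => False
  | .var p, i => i ∈ ν p
  | .dia R l, i => ∃ j, R.Holds i j ∧ l.Holds ν j
  | .box R l, i => ∀ j, R.Holds i j → l.Holds ν j

/-- Truth of a formula at an interval, under the valuation `ν`. -/
def Formula.Holds {T : Type u} [LinearOrder T] (ν : List Bool → Set (NonemptyInterval T)) :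
    Formula → NonemptyInterval T → Prop
  | .init l, i => l.Holds ν i
  | .clause ls l, _ => ∀ j, (∀ l' ∈ ls, l'.Holds ν j) → l.Holds ν j
  | .conj φ ψ, i => φ.Holds ν i ∧ ψ.Holds ν i

/-- The formula holds at some interval of some model based on an order from the class `C`. -/
def Formula.SatisfiableIn (C : Set LinOrd.{u}) (φ : Formula) : Prop :=
  ∃ T ∈ C, ∃ (ν : List Bool → Set (NonemptyInterval T)) (i : NonemptyInterval T), φ.Holds ν i

/-- Every non-maximal point has an immediate successor and every non-minimal point has an
immediate predecessor. -/
def IsDiscreteOrder (T : Type u) [LinearOrder T] : Prop :=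
  (∀ x : T, ¬ IsMax x → ∃ y, x ⋖ y) ∧ (∀ x : T, ¬ IsMin x → ∃ y, y ⋖ x)

/-! ### Formulas as words over a finite alphabet -/

/-- The alphabet in which formulas are written. -/
inductive Symb : Type
  | top | bot | var | bit (b : Bool) | endVar
  | dia (R : IntervalRel) | box (R : IntervalRel) | univ | imp | conj

instance : Finite IntervalRel :=
  Finite.of_surjective
    (fun n : Fin 12 => [IntervalRel.A, .B, .E, .D, .L, .O, .Ai, .Bi, .Ei, .Di, .Li, .Oi].get n)
    (fun R => by
      cases R
      exacts [⟨0, rfl⟩, ⟨1, rfl⟩, ⟨2, rfl⟩, ⟨3, rfl⟩, ⟨4, rfl⟩, ⟨5, rfl⟩, ⟨6, rfl⟩, ⟨7, rfl⟩,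
        ⟨8, rfl⟩, ⟨9, rfl⟩, ⟨10, rfl⟩, ⟨11, rfl⟩])

instance : Finite Symb :=
  Finite.of_surjective
    (Sum.elim (fun n : Fin 7 => [Symb.top, .bot, .var, .endVar, .univ, .imp, .conj].get n)
      (Sum.elim Symb.bit (Sum.elim Symb.dia Symb.box)))
    (fun s => by
      cases s with
      | top => exact ⟨.inl 0, rfl⟩
      | bot => exact ⟨.inl 1, rfl⟩
      | var => exact ⟨.inl 2, rfl⟩
      | endVar => exact ⟨.inl 3, rfl⟩
      | univ => exact ⟨.inl 4, rfl⟩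
      | imp => exact ⟨.inl 5, rfl⟩
      | conj => exact ⟨.inl 6, rfl⟩
      | bit b => exact ⟨.inr (.inl b), rfl⟩
      | dia R => exact ⟨.inr (.inr (.inl R)), rfl⟩
      | box R => exact ⟨.inr (.inr (.inr R)), rfl⟩)

/-- Literals in prefix notation. -/
def Literal.encode : Literal → List Symb
  | .top => [.top]
  | .bot => [.bot]
  | .var p => .var :: (p.map .bit ++ [.endVar])
  | .dia R l => .dia R :: l.encode
  | .box R l => .box R :: l.encode

/-- Formulas in prefix notation. -/
def Formula.encode : Formula → List Symb
  | .init l => l.encode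
  | .clause ls l => .univ :: (ls.flatMap Literal.encode ++ .imp :: l.encode)
  | .conj φ ψ => .conj :: (φ.encode ++ ψ.encode)

theorem bits_append_inj (p q : List Bool) (s t : List Symb)
    (h : p.map Symb.bit ++ Symb.endVar :: s = q.map Symb.bit ++ Symb.endVar :: t) :
    p = q ∧ s = t := by
  induction p generalizing q with
  | nil => cases q <;> simp_all
  | cons a p ih =>
    cases q with
    | nil => simp at h
    | cons b q =>
      simp only [List.map_cons, List.cons_append, List.cons.injEq, Symb.bit.injEq] at h
      obtain ⟨h1, h2⟩ := ih q h.2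
      exact ⟨by rw [h.1, h1], h2⟩

theorem Literal.encode_append_inj (l l' : Literal) (s t : List Symb)
    (h : l.encode ++ s = l'.encode ++ t) : l = l' ∧ s = t := by
  induction l generalizing l' with
  | top => cases l' <;> simp_all [Literal.encode]
  | bot => cases l' <;> simp_all [Literal.encode]
  | var p =>
    cases l' with
    | var q =>
      simp only [Literal.encode, List.cons_append, List.append_assoc, List.nil_append,
        List.cons.injEq, true_and] at h
      obtain ⟨h1, h2⟩ := bits_append_inj p q s t h
      exact ⟨by rw [h1], h2⟩
    | _ => simp [Literal.encode] at h
  | dia R l ih =>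
    cases l' with
    | dia R' l' =>
      simp only [Literal.encode, List.cons_append, List.cons.injEq, Symb.dia.injEq] at h
      obtain ⟨h1, h2⟩ := ih l' h.2
      exact ⟨by rw [h.1, h1], h2⟩
    | _ => simp [Literal.encode] at h
  | box R l ih =>
    cases l' with
    | box R' l' =>
      simp only [Literal.encode, List.cons_append, List.cons.injEq, Symb.box.injEq] at h
      obtain ⟨h1, h2⟩ := ih l' h.2
      exact ⟨by rw [h.1, h1], h2⟩
    | _ => simp [Literal.encode] at h

theorem Literal.encode_list_append_inj (ls ls' : List Literal) (s t : List Symb)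
    (h : ls.flatMap Literal.encode ++ Symb.imp :: s =
      ls'.flatMap Literal.encode ++ Symb.imp :: t) : ls = ls' ∧ s = t := by
  induction ls generalizing ls' with
  | nil =>
    cases ls' with
    | nil => simpa using h
    | cons l' ls' => cases l' <;> simp [Literal.encode] at h
  | cons l ls ih =>
    cases ls' with
    | nil => cases l <;> simp [Literal.encode] at h
    | cons l' ls' =>
      simp only [List.flatMap_cons, List.append_assoc] at h
      obtain ⟨h1, h2⟩ := Literal.encode_append_inj l l' _ _ h
      obtain ⟨h3, h4⟩ := ih ls' h2
      exact ⟨by rw [h1, h3], h4⟩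

theorem Formula.encode_append_inj (φ φ' : Formula) (s t : List Symb)
    (h : φ.encode ++ s = φ'.encode ++ t) : φ = φ' ∧ s = t := by
  induction φ generalizing φ' s t with
  | init l =>
    cases φ' with
    | init l' =>
      obtain ⟨h1, h2⟩ := Literal.encode_append_inj l l' s t h
      exact ⟨by rw [h1], h2⟩
    | _ => cases l <;> simp [Formula.encode, Literal.encode] at h
  | clause ls l =>
    cases φ' with
    | init l' => cases l' <;> simp [Formula.encode, Literal.encode] at h
    | clause ls' l' =>
      simp only [Formula.encode, List.cons_append, List.append_assoc, List.cons.injEq,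
        true_and] at h
      obtain ⟨h1, h2⟩ := Literal.encode_list_append_inj ls ls' _ _ h
      obtain ⟨h3, h4⟩ := Literal.encode_append_inj l l' s t h2
      exact ⟨by rw [h1, h3], h4⟩
    | conj _ _ => simp [Formula.encode] at h
  | conj φ ψ ih1 ih2 =>
    cases φ' with
    | init l' => cases l' <;> simp [Formula.encode, Literal.encode] at h
    | clause _ _ => simp [Formula.encode] at h
    | conj φ' ψ' =>
      simp only [Formula.encode, List.cons_append, List.append_assoc, List.cons.injEq,
        true_and] at h
      obtain ⟨h1, h2⟩ := ih1 φ' _ _ h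
      obtain ⟨h3, h4⟩ := ih2 ψ' s t h2
      exact ⟨by rw [h1, h3], h4⟩

/-- Distinct formulas are written as distinct words. -/
theorem Formula.encode_injective : Function.Injective Formula.encode := fun φ ψ h =>
  (Formula.encode_append_inj φ ψ [] [] (by rw [h])).1

/-- The satisfiability problem, over the class `C` and under the irreflexive semantics, for
core formulas without diamond operators: the set of the words that write such a satisfiable
formula. -/
def coreBoxSat (C : Set LinOrd.{u}) : Set (List Symb) :=
  {w | ∃ φ : Formula, φ.IsBox ∧ φ.IsCore ∧ φ.SatisfiableIn C ∧ φ.encode = w}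

/-! ### Polynomial space and hardness for it -/

/-- What a single-tape machine does in one step, besides changing its state. -/
inductive Action (S : Type) : Type
  | write (s : S)
  | left
  | right

/-- Deterministic Turing machines with one right-infinite tape and input alphabet `A`. -/
structure TM (A : Type) where
  /-- states -/
  Q : Type
  /-- tape alphabet -/
  S : Type
  [finQ : Finite Q]
  [finS : Finite S]
  blank : S
  input : A ↪ S
  input_ne_blank : ∀ a, input a ≠ blank
  start : Q
  accept : Q
  reject : Q
  accept_ne_reject : accept ≠ reject
  /-- transition function; its values at the two halting states are not used -/
  δ : Q → S → Q × Action S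

namespace TM

variable {A : Type} (M : TM A)

/-- Configurations: state, head position, tape contents. -/
structure Config where
  state : M.Q
  head : ℕ
  tape : ℕ → M.S

/-- The head on the leftmost cell `0`, the input on the first cells, blanks elsewhere. -/
def initial (x : List A) : M.Config where
  state := M.start
  head := 0
  tape i := (x[i]?).elim M.blank M.input

open Classical in
/-- One step. Halting configurations do not change; a left move on the leftmost cell leaves the
head where it is. -/
noncomputable def step (c : M.Config) : M.Config :=
  if c.state = M.accept ∨ c.state = M.reject then c
  else match M.δ c.state (c.tape c.head) with
    | (q, .write s) => ⟨q, c.head, Function.update c.tape c.head s⟩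
    | (q, .left) => ⟨q, c.head - 1, c.tape⟩
    | (q, .right) => ⟨q, c.head + 1, c.tape⟩

/-- The configuration after `n` steps on input `x`. -/
noncomputable def run (x : List A) (n : ℕ) : M.Config := M.step^[n] (M.initial x)

/-- The machine halts on every input, and it accepts exactly the words in `L`. -/
def Decides (L : Set (List A)) : Prop :=
  ∀ x, (x ∈ L → ∃ n, (M.run x n).state = M.accept) ∧
    (x ∉ L → ∃ n, (M.run x n).state = M.reject)

/-- On input `x` the head visits no cell outside the first `p(|x|)` cells. -/
def SpaceBoundedBy (p : Polynomial ℕ) : Prop :=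
  ∀ x n, (M.run x n).head < p.eval x.length

end TM

/-- Languages decided by a deterministic Turing machine in polynomial space. -/
def InPSpace {A : Type} (L : Set (List A)) : Prop :=
  ∃ (M : TM A) (p : Polynomial ℕ), M.Decides L ∧ M.SpaceBoundedBy p

/-- Every language in PSPACE (over any finite alphabet) is many-one reducible to `S` by a function
that a Turing machine computes in polynomial time. -/
def IsPSpaceHard {Γ : Type} [Finite Γ] (S : Set (List Γ)) : Prop :=
  ∀ (A : Type) [Finite A] (L : Set (List A)), InPSpace L →
    ∃ f : List A → List Γ,
      Nonempty (Turing.TM2ComputableInPolyTime (id : List A → List A) (id : List Γ → List Γ) f) ∧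
      ∀ x, x ∈ L ↔ f x ∈ S

end HSLogic

namespace HSLogic

/-! ### Gadgets on punctual intervals -/

section Gadgets

variable {T : Type u} [LinearOrder T]

/-- The punctual interval `⟨t, t⟩`. -/
abbrev pt (t : T) : NonemptyInterval T := NonemptyInterval.pure t

theorem eq_pure_of_le {I : NonemptyInterval T} {t : T} (h₁ : t ≤ I.fst) (h₂ : I.snd ≤ t) :
    I = pt t := by
  have h := I.fst_le_snd
  ext
  · exact le_antisymm (h.trans h₂) h₁
  · exact le_antisymm h₂ (h₁.trans h)

/-- If `[B]P` implies `[E]Q` everywhere then `Q` holds one point after `P`. -/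
theorem next_forced {P Q : Set (NonemptyInterval T)}
    (h : ∀ I, (∀ J, IntervalRel.B.Holds I J → J ∈ P) → ∀ J, IntervalRel.E.Holds I J → J ∈ Q)
    {t v : T} (htv : t ⋖ v) (hP : pt t ∈ P) : pt v ∈ Q := by
  refine h ⟨(t, v), htv.le⟩ ?_ (pt v) ⟨htv.lt, rfl⟩
  rintro J ⟨h₁, h₂⟩
  have h₁' : t = J.fst := h₁
  have h₂' : J.snd < v := h₂
  rwa [eq_pure_of_le h₁'.le (htv.le_of_lt h₂')]

/-- If `P` is true at punctual intervals only and `Q` holds one point after `P`, then `[B]P`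
implies `[E]Q`. -/
theorem next_sound {P Q : Set (NonemptyInterval T)} (hP : ∀ I ∈ P, I.fst = I.snd)
    (h : ∀ t v, t ⋖ v → pt t ∈ P → pt v ∈ Q) (I : NonemptyInterval T)
    (hI : ∀ J, IntervalRel.B.Holds I J → J ∈ P) (J : NonemptyInterval T)
    (hJ : IntervalRel.E.Holds I J) : J ∈ Q := by
  obtain ⟨h₁, h₂⟩ := hJ
  have hlt : I.fst < I.snd := h₁.trans_le (J.fst_le_snd.trans h₂.ge)
  have hcov : I.fst ⋖ I.snd := ⟨hlt, fun w hw hw' =>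
    hw.ne (hP ⟨(I.fst, w), hw.le⟩ (hI _ ⟨rfl, hw'⟩))⟩
  have hJ : J = pt I.snd := eq_pure_of_le (hcov.ge_of_gt h₁) h₂.ge
  exact hJ ▸ h _ _ hcov (hI (pt I.fst) ⟨rfl, hlt⟩)

/-- `R` is forced at a point where `Q` holds and before which `P` holds. -/
theorem and_forced {P Q Z R : Set (NonemptyInterval T)} (h₁ : ∀ I ∈ P, I ∈ Z)
    (h₂ : ∀ I ∈ Q, ∀ J, IntervalRel.Ei.Holds I J → J ∈ Z)
    (h₃ : ∀ I, (∀ J, IntervalRel.B.Holds I J → J ∈ Z) → ∀ J, IntervalRel.D.Holds I J → J ∈ R)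
    {t v w : T} (htv : t ⋖ v) (hvw : v ⋖ w) (hP : pt t ∈ P) (hQ : pt v ∈ Q) :
    pt v ∈ R := by
  refine h₃ ⟨(t, w), (htv.lt.trans hvw.lt).le⟩ ?_ (pt v) ⟨htv.lt, hvw.lt⟩
  rintro J ⟨hJ₁, hJ₂⟩
  have hJ₁' : t = J.fst := hJ₁
  have hJ₂' : J.snd < w := hJ₂
  rcases (hvw.le_of_lt hJ₂').lt_or_eq with hlt | heq
  · rw [eq_pure_of_le hJ₁'.le (htv.le_of_lt hlt)]
    exact h₁ _ hP
  · exact h₂ _ hQ J ⟨hJ₁' ▸ htv.lt, heq.symm⟩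

/-- The gadget for conjunction forces nothing but the conjunctions. -/
theorem and_sound (hT : ∀ x : T, ¬ IsMax x → ∃ y, x ⋖ y) {Z R : Set (NonemptyInterval T)}
    {p q : T → Prop} (h₁ : ∀ t, pt t ∈ Z → p t) (h₂ : ∀ I ∈ Z, I.fst < I.snd → q I.snd)
    (hq : ∀ t v, t ⋖ v → q t → ¬ q v) (hR : ∀ t v, t ⋖ v → p t → q v → pt v ∈ R)
    (I : NonemptyInterval T) (hI : ∀ J, IntervalRel.B.Holds I J → J ∈ Z)
    (J : NonemptyInterval T) (hJ : IntervalRel.D.Holds I J) : J ∈ R := by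
  obtain ⟨hJ₁, hJ₂⟩ := hJ
  have hJle := J.fst_le_snd
  have hp : p I.fst := h₁ _ (hI (pt I.fst) ⟨rfl, hJ₁.trans_le (hJle.trans hJ₂.le)⟩)
  have hqw : ∀ w, I.fst < w → w < I.snd → q w := fun w hw hw' =>
    h₂ ⟨(I.fst, w), hw.le⟩ (hI _ ⟨rfl, hw'⟩) hw
  obtain ⟨v, hv⟩ := hT I.fst (not_isMax_of_lt hJ₁)
  have hvJ : v ≤ J.fst := hv.ge_of_gt hJ₁
  have hqv := hqw v hv.lt ((hvJ.trans hJle).trans_lt hJ₂)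
  have hJv : J.snd ≤ v := by
    by_contra! hlt
    obtain ⟨w, hw⟩ := hT v (not_isMax_of_lt hlt)
    exact hq v w hw hqv (hqw w (hv.lt.trans hw.lt) ((hw.ge_of_gt hlt).trans_lt hJ₂))
  exact eq_pure_of_le hvJ hJv ▸ hR _ _ hv hp hqv

end Gadgets

/-! ### The formula describing a computation -/

namespace TM

variable {A : Type} (M : TM A)

/-- Families of propositional variables, each indexed by the cells of the tape: `cell s` says that
the cell contains `s`, `hd (some q)` that the head is on it in state `q`, `hd none` that the
machine is running with its head elsewhere, `gr` and `gl` that the head is to the left and to the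
right of the cell, respectively; the others are auxiliary. -/
inductive Family : Type
  | cell (s : M.S)
  | hd (c : Option M.Q)
  | hdNext (c : Option M.Q)
  | both (c : Option M.Q) (s : M.S)
  | res (c : Option M.Q) (s : M.S)
  | gr
  | gl

instance : Countable M.Family := by
  have := M.finQ
  have := M.finS
  let g : M.Family → Fin 7 × Option (Option M.Q) × Option M.S := fun
    | .cell s => (0, none, some s)
    | .hd c => (1, some c, none)
    | .hdNext c => (2, some c, none)
    | .both c s => (3, some c, some s)
    | .res c s => (4, some c, some s)
    | .gr => (5, none, none)
    | .gl => (6, none, none)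
  have hg : Function.Injective g := by
    intro a b h
    cases a <;> cases b <;> simp_all [g]
  exact hg.countable

noncomputable def familyCode : M.Family → ℕ := (exists_injective_nat M.Family).choose

theorem familyCode_injective : Function.Injective M.familyCode :=
  (exists_injective_nat M.Family).choose_spec

/-- The name of the variable of the family `v` for the cell `i`. -/
noncomputable def name (v : M.Family) (i : ℕ) : List Bool :=
  List.replicate (M.familyCode v) false ++ List.replicate i true

theorem name_inj {v w : M.Family} {i j : ℕ} (h : M.name v i = M.name w j) : v = w ∧ i = j := by
  have h₁ := congrArg (List.count false) h
  have h₂ := congrArg (List.count true) h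
  simp [name, List.count_replicate] at h₁ h₂
  exact ⟨M.familyCode_injective h₁, h₂⟩

noncomputable def lit (v : M.Family) (i : ℕ) : Literal := .var (M.name v i)

/-- `[U](l₁ → l₂)` -/
def _root_.HSLogic.Formula.imp (l₁ l₂ : Literal) : Formula := .clause [l₁] l₂

/-- `[U]([B]v → [E]w)`, which carries `v` over to `w` at the next point. -/
noncomputable def nextClause (v : M.Family) (i : ℕ) (w : M.Family) (j : ℕ) : Formula :=
  .imp (.box .B (M.lit v i)) (.box .E (M.lit w j))

def Halting (q : M.Q) : Prop := q = M.accept ∨ q = M.reject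

noncomputable def elems (α : Type) [Finite α] : List α :=
  (@Finset.univ α (Fintype.ofFinite α)).toList

@[simp] theorem mem_elems {α : Type} [Finite α] (a : α) : a ∈ elems α := by
  simp [elems]

attribute [instance] TM.finQ TM.finS

open Classical in
noncomputable def headClauses (i : ℕ) : Option M.Q → List Formula
  | none => [M.nextClause (.hd none) i (.hdNext none) i,
      .imp (M.lit .gr i) (M.lit .gr (i + 1)), .imp (M.lit .gr i) (M.lit (.hd none) i),
      .imp (M.lit .gl (i + 1)) (M.lit .gl i), .imp (M.lit .gl i) (M.lit (.hd none) i)]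
  | some q => if q = M.reject then [.imp (M.lit (.hd (some q)) i) .bot]
      else if q = M.accept then []
      else [M.nextClause (.hd (some q)) i (.hdNext (some q)) i,
        .clause [M.lit (.hd (some q)) i, .box .Bi (.box .Bi .bot)] .bot,
        .imp (M.lit (.hd (some q)) i) (M.lit .gr (i + 1)),
        .imp (M.lit (.hd (some q)) (i + 1)) (M.lit .gl i)]

noncomputable def andClauses (i : ℕ) (c : Option M.Q) (s : M.S) : List Formula :=
  [.imp (M.lit (.cell s) i) (M.lit (.both c s) i),
    .imp (M.lit (.hdNext c) i) (.box .Ei (M.lit (.both c s) i)),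
    .imp (.box .B (M.lit (.both c s) i)) (.box .D (M.lit (.res c s) i))]

open Classical in
noncomputable def resClauses (i : ℕ) : Option M.Q → M.S → List Formula
  | none, s => [M.nextClause (.res none s) i (.cell s) i]
  | some q, s => if M.Halting q then [] else match M.δ q s with
    | (q', .write s') => [M.nextClause (.res (some q) s) i (.cell s') i,
        M.nextClause (.res (some q) s) i (.hd (some q')) i]
    | (q', .left) => [M.nextClause (.res (some q) s) i (.cell s) i,
        M.nextClause (.res (some q) s) (i + 1) (.hd (some q')) i]
    | (q', .right) => [M.nextClause (.res (some q) s) i (.cell s) i,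
        M.nextClause (.res (some q) s) i (.hd (some q')) (i + 1)]

open Classical in
/-- Left moves on the leftmost cell. -/
noncomputable def leftmostClauses (q : M.Q) (s : M.S) : List Formula :=
  if M.Halting q then [] else match M.δ q s with
    | (q', .left) => [M.nextClause (.res (some q) s) 0 (.hd (some q')) 0]
    | _ => []

/-- The clauses for the cell `i` with initial content `s`. -/
noncomputable def block (s : M.S) (i : ℕ) : List Formula :=
  .init (M.lit (.cell s) i) :: ((elems (Option M.Q)).flatMap (M.headClauses i) ++
    (elems (Option M.Q × M.S)).flatMap fun c => M.andClauses i c.1 c.2 ++ M.resClauses i c.1 c.2)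

noncomputable def baseClauses : List Formula :=
  .init (M.lit (.hd (some M.start)) 0) ::
    (elems (M.Q × M.S)).flatMap fun c => M.leftmostClauses c.1 c.2

def _root_.HSLogic.Formula.conjs (l : List Formula) (φ : Formula) : Formula := l.foldr .conj φ

/-- The formula for the initial tape `τ`, restricted to the first `N` cells. -/
noncomputable def formula (τ : ℕ → M.S) (N : ℕ) : Formula :=
  .conjs ((List.range N).reverse.flatMap (fun i => M.block (τ i) i) ++ M.baseClauses)
    (.init (.box .B .bot))

end TM

theorem Formula.holds_conjs {T : Type u} [LinearOrder T] {ν : List Bool → Set (NonemptyInterval T)}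
    {I : NonemptyInterval T} {l : List Formula} {φ : Formula} :
    (Formula.conjs l φ).Holds ν I ↔ (∀ ψ ∈ l, ψ.Holds ν I) ∧ φ.Holds ν I := by
  induction l with
  | nil => simp [Formula.conjs]
  | cons a l ih =>
    simp only [Formula.conjs, List.foldr_cons, Formula.Holds, List.mem_cons] at ih ⊢
    rw [ih]
    simp [and_assoc]

theorem Formula.isBox_conjs {l : List Formula} {φ : Formula} :
    (Formula.conjs l φ).IsBox ↔ (∀ ψ ∈ l, ψ.IsBox) ∧ φ.IsBox := by
  induction l with
  | nil => simp [Formula.conjs]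
  | cons a l ih =>
    simp only [Formula.conjs, List.foldr_cons, Formula.IsBox, List.mem_cons] at ih ⊢
    rw [ih]
    simp [and_assoc]

theorem Formula.isCore_conjs {l : List Formula} {φ : Formula} :
    (Formula.conjs l φ).IsCore ↔ (∀ ψ ∈ l, ψ.IsCore) ∧ φ.IsCore := by
  induction l with
  | nil => simp [Formula.conjs]
  | cons a l ih =>
    simp only [Formula.conjs, List.foldr_cons, Formula.IsCore, List.mem_cons] at ih ⊢
    rw [ih]
    simp [and_assoc]

namespace TM

variable {A : Type} (M : TM A)

/-- Every clause of `formula` satisfies `P`, if the clauses of all its parts do. -/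
theorem forall_mem_formula {P : Formula → Prop} (τ : ℕ → M.S) (N : ℕ)
    (h₁ : ∀ i, P (.init (M.lit (.cell (τ i)) i))) (h₂ : ∀ i c, ∀ ψ ∈ M.headClauses i c, P ψ)
    (h₃ : ∀ i c s, ∀ ψ ∈ M.andClauses i c s, P ψ) (h₄ : ∀ i c s, ∀ ψ ∈ M.resClauses i c s, P ψ)
    (h₅ : P (.init (M.lit (.hd (some M.start)) 0)))
    (h₆ : ∀ q s, ∀ ψ ∈ M.leftmostClauses q s, P ψ) :
    ∀ ψ ∈ (List.range N).reverse.flatMap (fun i => M.block (τ i) i) ++ M.baseClauses, P ψ := by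
  intro ψ hψ
  simp only [List.mem_append, List.mem_flatMap, block, baseClauses, List.mem_cons] at hψ
  rcases hψ with ⟨i, -, rfl | ⟨c, -, hc⟩ | ⟨c, -, hc | hc⟩⟩ | rfl | ⟨c, -, hc⟩
  exacts [h₁ i, h₂ _ _ _ hc, h₃ _ _ _ _ hc, h₄ _ _ _ _ hc, h₅, h₆ _ _ _ hc]

theorem formula_isBox (τ : ℕ → M.S) (N : ℕ) : (M.formula τ N).IsBox := by
  refine Formula.isBox_conjs.2 ⟨M.forall_mem_formula τ N ?_ ?_ ?_ ?_ ?_ ?_, trivial⟩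
  · simp [Formula.IsBox, Literal.IsBox, lit]
  · intro i c ψ h
    unfold headClauses at h
    split at h
    · simp only [List.mem_cons, List.not_mem_nil, or_false] at h
      rcases h with rfl | rfl | rfl | rfl | rfl <;>
      simp [Formula.IsBox, Literal.IsBox, lit, Formula.imp, nextClause]
    · split_ifs at h
      · simp only [List.mem_cons, List.not_mem_nil, or_false] at h
        subst h
        simp [Formula.IsBox, Literal.IsBox, lit, Formula.imp]
      · simp at h
      · simp only [List.mem_cons, List.not_mem_nil, or_false] at h
        rcases h with rfl | rfl | rfl | rfl <;>
        simp [Formula.IsBox, Literal.IsBox, lit, Formula.imp, nextClause]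
  · intro i c s ψ h
    simp only [andClauses, List.mem_cons, List.not_mem_nil, or_false] at h
    rcases h with rfl | rfl | rfl <;> simp [Formula.IsBox, Literal.IsBox, lit, Formula.imp]
  · intro i c s ψ h
    unfold resClauses at h
    split at h
    · simp only [List.mem_cons, List.not_mem_nil, or_false] at h
      subst h
      simp [Formula.IsBox, Literal.IsBox, lit, Formula.imp, nextClause]
    · split_ifs at h
      · simp at h
      · split at h <;>
        · simp only [List.mem_cons, List.not_mem_nil, or_false] at h
          rcases h with rfl | rfl <;>
          simp [Formula.IsBox, Literal.IsBox, lit, Formula.imp, nextClause]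
  · simp [Formula.IsBox, Literal.IsBox, lit]
  · intro q s ψ h
    unfold leftmostClauses at h
    split_ifs at h
    · simp at h
    · split at h
      · simp only [List.mem_cons, List.not_mem_nil, or_false] at h
        subst h
        simp [Formula.IsBox, Literal.IsBox, lit, Formula.imp, nextClause]
      · simp at h

theorem formula_isCore (τ : ℕ → M.S) (N : ℕ) : (M.formula τ N).IsCore := by
  refine Formula.isCore_conjs.2 ⟨M.forall_mem_formula τ N ?_ ?_ ?_ ?_ ?_ ?_, trivial⟩
  · simp [Formula.IsCore]
  · intro i c ψ h
    unfold headClauses at h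
    split at h
    · simp only [List.mem_cons, List.not_mem_nil, or_false] at h
      rcases h with rfl | rfl | rfl | rfl | rfl <;>
      simp [Formula.IsCore, Formula.imp, nextClause]
    · split_ifs at h
      · simp only [List.mem_cons, List.not_mem_nil, or_false] at h
        subst h
        simp [Formula.IsCore, Formula.imp]
      · simp at h
      · simp only [List.mem_cons, List.not_mem_nil, or_false] at h
        rcases h with rfl | rfl | rfl | rfl <;>
        simp [Formula.IsCore, Formula.imp, nextClause]
  · intro i c s ψ h
    simp only [andClauses, List.mem_cons, List.not_mem_nil, or_false] at h
    rcases h with rfl | rfl | rfl <;> simp [Formula.IsCore, Formula.imp]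
  · intro i c s ψ h
    unfold resClauses at h
    split at h
    · simp only [List.mem_cons, List.not_mem_nil, or_false] at h
      subst h
      simp [Formula.IsCore, Formula.imp, nextClause]
    · split_ifs at h
      · simp at h
      · split at h <;>
        · simp only [List.mem_cons, List.not_mem_nil, or_false] at h
          rcases h with rfl | rfl <;>
          simp [Formula.IsCore, Formula.imp, nextClause]
  · simp [Formula.IsCore]
  · intro q s ψ h
    unfold leftmostClauses at h
    split_ifs at h
    · simp at h
    · split at h
      · simp only [List.mem_cons, List.not_mem_nil, or_false] at h
        subst h
        simp [Formula.IsCore, Formula.imp, nextClause]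
      · simp at h

end TM

end HSLogic

namespace HSLogic
namespace TM

variable {A : Type} (M : TM A)

theorem run_succ (x : List A) (k : ℕ) : M.run x (k + 1) = M.step (M.run x k) :=
  Function.iterate_succ_apply' _ _ _

theorem step_of_halting {c : M.Config} (h : M.Halting c.state) : M.step c = c := if_pos h

theorem step_of_not_halting {c : M.Config} (h : ¬ M.Halting c.state) :
    M.step c = match M.δ c.state (c.tape c.head) with
      | (q, .write s) => ⟨q, c.head, Function.update c.tape c.head s⟩
      | (q, .left) => ⟨q, c.head - 1, c.tape⟩
      | (q, .right) => ⟨q, c.head + 1, c.tape⟩ := if_neg h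

theorem run_of_halting {x : List A} {m n : ℕ} (h : M.Halting (M.run x m).state) (hmn : m ≤ n) :
    M.run x n = M.run x m := by
  induction n, hmn using Nat.le_induction with
  | base => rfl
  | succ n _ ih => rw [run_succ, ih, step_of_halting _ h]

theorem step_tape_of_ne {c : M.Config} {i : ℕ} (h : i ≠ c.head) : (M.step c).tape i = c.tape i := by
  by_cases hc : M.Halting c.state
  · rw [M.step_of_halting hc]
  · rw [M.step_of_not_halting hc]
    split <;> simp [h]

/-! ### Rejecting computations -/

section Unsat

variable {T : Type u} [LinearOrder T] {ν : List Bool → Set (NonemptyInterval T)}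

theorem imp_lit {v w : M.Family} {i j : ℕ} {I : NonemptyInterval T}
    (h : (Formula.imp (M.lit v i) (M.lit w j)).Holds ν I) (J : NonemptyInterval T)
    (hJ : J ∈ ν (M.name v i)) : J ∈ ν (M.name w j) := by
  refine h J fun l hl => ?_
  rw [List.mem_singleton.1 hl]
  exact hJ

theorem nextClause_forced {v w : M.Family} {i j : ℕ} {I : NonemptyInterval T}
    (h : (M.nextClause v i w j).Holds ν I) {t t' : T} (ht : t ⋖ t')
    (hv : pt t ∈ ν (M.name v i)) : pt t' ∈ ν (M.name w j) := by
  refine next_forced (fun J hJ => h J fun l hl => ?_) ht hv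
  rw [List.mem_singleton.1 hl]
  exact hJ

theorem andClauses_forced {i : ℕ} {c : Option M.Q} {s : M.S} {I : NonemptyInterval T}
    (h : ∀ ψ ∈ M.andClauses i c s, ψ.Holds ν I) {t v w : T} (htv : t ⋖ v) (hvw : v ⋖ w)
    (h₁ : pt t ∈ ν (M.name (.cell s) i)) (h₂ : pt v ∈ ν (M.name (.hdNext c) i)) :
    pt v ∈ ν (M.name (.res c s) i) := by
  simp only [andClauses, List.forall_mem_cons] at h
  refine and_forced (M.imp_lit h.1) (fun J hJ => h.2.1 J fun l hl => ?_)
    (fun J hJ => h.2.2.1 J fun l hl => ?_) htv hvw h₁ h₂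
  all_goals
    rw [List.mem_singleton.1 hl]
    exact hJ

variable {N : ℕ} {τ : ℕ → M.S} {I : NonemptyInterval T}

theorem block_mem_formula (h : (M.formula τ N).Holds ν I) {i : ℕ} (hi : i < N) {ψ : Formula}
    (hψ : ψ ∈ M.block (τ i) i) : ψ.Holds ν I := by
  refine (Formula.holds_conjs.1 h).1 ψ (List.mem_append_left _ (List.mem_flatMap.2 ⟨i, ?_, hψ⟩))
  simpa using hi

theorem headClauses_holds (h : (M.formula τ N).Holds ν I) {i : ℕ} (hi : i < N) (c : Option M.Q) :
    ∀ ψ ∈ M.headClauses i c, ψ.Holds ν I := fun _ hψ =>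
  M.block_mem_formula h hi (List.mem_cons_of_mem _ (List.mem_append_left _
    (List.mem_flatMap.2 ⟨c, mem_elems c, hψ⟩)))

theorem andClauses_holds (h : (M.formula τ N).Holds ν I) {i : ℕ} (hi : i < N) (c : Option M.Q)
    (s : M.S) : ∀ ψ ∈ M.andClauses i c s, ψ.Holds ν I := fun _ hψ =>
  M.block_mem_formula h hi (List.mem_cons_of_mem _ (List.mem_append_right _
    (List.mem_flatMap.2 ⟨(c, s), mem_elems _, List.mem_append_left _ hψ⟩)))

theorem resClauses_holds (h : (M.formula τ N).Holds ν I) {i : ℕ} (hi : i < N) (c : Option M.Q)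
    (s : M.S) : ∀ ψ ∈ M.resClauses i c s, ψ.Holds ν I := fun _ hψ =>
  M.block_mem_formula h hi (List.mem_cons_of_mem _ (List.mem_append_right _
    (List.mem_flatMap.2 ⟨(c, s), mem_elems _, List.mem_append_right _ hψ⟩)))

theorem leftmostClauses_holds (h : (M.formula τ N).Holds ν I) (q : M.Q)
    (s : M.S) : ∀ ψ ∈ M.leftmostClauses q s, ψ.Holds ν I := fun _ hψ =>
  (Formula.holds_conjs.1 h).1 _ (List.mem_append_right _ (List.mem_cons_of_mem _
    (List.mem_flatMap.2 ⟨(q, s), mem_elems _, hψ⟩)))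

/-- The configuration `c`, restricted to the first `N` cells, is described at the point `t`. -/
def Describes (ν : List Bool → Set (NonemptyInterval T)) (N : ℕ) (c : M.Config) (t : T) : Prop :=
  (∀ i < N, pt t ∈ ν (M.name (.cell (c.tape i)) i)) ∧
    pt t ∈ ν (M.name (.hd (some c.state)) c.head)

theorem exists_lt_lt_of_describes (h : (M.formula τ N).Holds ν I) {c : M.Config} {t : T}
    (hc : M.Describes ν N c t) (hN : c.head < N) (hh : ¬ M.Halting c.state) :
    ∃ v w : T, t < v ∧ v < w := by
  have h' := M.headClauses_holds h hN (some c.state)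
  rw [Halting, not_or] at hh
  simp only [headClauses, if_neg hh.1, if_neg hh.2, List.forall_mem_cons] at h'
  by_contra! hcon
  refine h'.2.1 (pt t) fun l hl => ?_
  simp only [List.mem_cons, List.not_mem_nil, or_false] at hl
  rcases hl with rfl | rfl
  · exact hc.2
  · rintro J ⟨hJ₁, hJ₂⟩ K ⟨hK₁, hK₂⟩
    exact absurd hK₂ (hcon _ _ hJ₂).not_gt

theorem elsewhere_of_describes (h : (M.formula τ N).Holds ν I) {c : M.Config} {t : T}
    (hc : M.Describes ν N c t) (hN : c.head < N) (hh : ¬ M.Halting c.state) {i : ℕ} (hi : i < N)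
    (hne : i ≠ c.head) : pt t ∈ ν (M.name (.hd none) i) := by
  have hq := fun j (hj : j < N) => M.headClauses_holds h hj (some c.state)
  have hn := fun j (hj : j < N) => M.headClauses_holds h hj none
  rw [Halting, not_or] at hh
  simp only [headClauses, if_neg hh.1, if_neg hh.2, List.forall_mem_cons] at hq hn
  rcases lt_or_gt_of_ne hne with hlt | hgt
  · have hgl : ∀ d, i + d + 1 = c.head → pt t ∈ ν (M.name .gl i) := by
      intro d
      induction d generalizing i with
      | zero =>
        intro hd
        refine M.imp_lit (hq i hi).2.2.2.1 _ ?_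
        rw [show i + 1 = c.head from hd]
        exact hc.2
      | succ d ih =>
        intro hd
        exact M.imp_lit (hn i hi).2.2.2.1 _
          (ih (i := i + 1) (by omega) (by omega) (by omega) (by omega))
    exact M.imp_lit (hn i hi).2.2.2.2.1 _ (hgl (c.head - i - 1) (by omega))
  · have hgr : ∀ j, c.head < j → j < N → pt t ∈ ν (M.name .gr j) := by
      intro j hj
      induction j, hj using Nat.le_induction with
      | base => exact fun _ => M.imp_lit (hq _ hN).2.2.1 _ hc.2
      | succ j hj ih => exact fun hjN => M.imp_lit (hn j (by omega)).2.1 _ (ih (by omega))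
    exact M.imp_lit (hn i hi).2.2.1 _ (hgr i hgt hi)

theorem describes_step (hT : ∀ x : T, ¬ IsMax x → ∃ y, x ⋖ y) (h : (M.formula τ N).Holds ν I)
    {c : M.Config} {t : T} (hc : M.Describes ν N c t) (hN : c.head < N)
    (hh : ¬ M.Halting c.state) : ∃ t', M.Describes ν N (M.step c) t' := by
  obtain ⟨y, y', hy, hy'⟩ := M.exists_lt_lt_of_describes h hc hN hh
  obtain ⟨v, hv⟩ := hT t (not_isMax_of_lt hy)
  obtain ⟨w, hw⟩ := hT v (not_isMax_of_lt ((hv.ge_of_gt hy).trans_lt hy'))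
  have hres : ∀ c' i, i < N → pt t ∈ ν (M.name (.hd c') i) →
      M.nextClause (.hd c') i (.hdNext c') i ∈ M.headClauses i c' →
      pt v ∈ ν (M.name (.res c' (c.tape i)) i) := fun c' i hi hp hm =>
    M.andClauses_forced (M.andClauses_holds h hi c' (c.tape i)) hv hw (hc.1 i hi)
      (M.nextClause_forced (M.headClauses_holds h hi c' _ hm) hv hp)
  have hcell : ∀ i < N, i ≠ c.head → pt w ∈ ν (M.name (.cell ((M.step c).tape i)) i) := by
    intro i hi hne
    rw [M.step_tape_of_ne hne]
    exact M.nextClause_forced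
      (M.resClauses_holds h hi none (c.tape i) _ (by simp [resClauses])) hw
      (hres none i hi (M.elsewhere_of_describes h hc hN hh hi hne) (by simp [headClauses]))
  have hhead := hres (some c.state) c.head hN hc.2 (by
    rw [Halting, not_or] at hh
    simp [headClauses, hh.1, hh.2])
  have hr := M.resClauses_holds h hN (some c.state) (c.tape c.head)
  have hl := M.leftmostClauses_holds h c.state (c.tape c.head)
  simp only [resClauses, if_neg hh] at hr
  simp only [leftmostClauses, if_neg hh] at hl
  suffices hs : pt w ∈ ν (M.name (.cell ((M.step c).tape c.head)) c.head) ∧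
      pt w ∈ ν (M.name (.hd (some (M.step c).state)) (M.step c).head) by
    refine ⟨w, fun i hi => ?_, hs.2⟩
    rcases eq_or_ne i c.head with rfl | hne
    exacts [hs.1, hcell i hi hne]
  rw [M.step_of_not_halting hh]
  split at hr
  · rename_i q' s' heq
    simp only [List.forall_mem_cons] at hr
    simp only [heq, Function.update_self]
    exact ⟨M.nextClause_forced hr.1 hw hhead, M.nextClause_forced hr.2.1 hw hhead⟩
  · rename_i q' heq
    simp only [heq, List.forall_mem_cons] at hr hl ⊢
    refine ⟨M.nextClause_forced hr.1 hw hhead, ?_⟩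
    rcases Nat.eq_zero_or_pos c.head with h0 | hpos
    · rw [h0] at hhead hl ⊢
      exact M.nextClause_forced hl.1 hw hhead
    · have hr' := M.resClauses_holds h (i := c.head - 1) (by omega) (some c.state) (c.tape c.head)
      simp only [resClauses, if_neg hh, heq, List.forall_mem_cons,
        Nat.sub_add_cancel hpos] at hr'
      exact M.nextClause_forced hr'.2.1 hw hhead
  · rename_i q' heq
    simp only [List.forall_mem_cons] at hr
    simp only [heq]
    exact ⟨M.nextClause_forced hr.1 hw hhead, M.nextClause_forced hr.2.1 hw hhead⟩

theorem formula_unsat (hT : ∀ x : T, ¬ IsMax x → ∃ y, x ⋖ y) {x : List A}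
    (hN : ∀ n, (M.run x n).head < N) (hrej : ∃ n, (M.run x n).state = M.reject) :
    ¬ (M.formula (M.initial x).tape N).Holds ν I := by
  intro h
  obtain ⟨n, hn⟩ := hrej
  have hpunct : ∃ t, I = pt t := by
    refine ⟨I.fst, eq_pure_of_le le_rfl ?_⟩
    by_contra! hlt
    exact (Formula.holds_conjs.1 h).2 (pt I.fst) ⟨rfl, hlt⟩
  obtain ⟨t₀, rfl⟩ := hpunct
  have key : ∀ k, ∃ t, M.Describes ν N (M.run x k) t := by
    intro k
    induction k with
    | zero =>
      refine ⟨t₀, fun i hi => M.block_mem_formula h hi List.mem_cons_self, ?_⟩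
      exact (Formula.holds_conjs.1 h).1 _ (List.mem_append_right _ List.mem_cons_self)
    | succ k ih =>
      obtain ⟨t, ht⟩ := ih
      rw [run_succ]
      by_cases hh : M.Halting (M.run x k).state
      · exact ⟨t, by rwa [M.step_of_halting hh]⟩
      · exact M.describes_step hT h ht (hN k) hh
  obtain ⟨t, ht⟩ := key n
  have hc := M.headClauses_holds h (hN n) (some M.reject)
  simp only [headClauses, if_true, List.forall_mem_cons] at hc
  refine hc.1 (pt t) fun l hl => ?_
  rw [List.mem_singleton.1 hl, ← hn]
  exact ht.2

end Unsat

/-! ### Accepting computations -/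

section Sat

variable {T : Type u} [LinearOrder T] (x : List A) (n : ℕ) (a : ℕ → T)

/-- The facts about the `k`-th configuration that are true at the point for it. -/
def Fact (k : ℕ) : M.Family → ℕ → Prop
  | .cell s, i => (M.run x k).tape i = s
  | .hd (some q), i => (M.run x k).state = q ∧ (M.run x k).head = i
  | .hd none, i => ¬ M.Halting (M.run x k).state ∧ i ≠ (M.run x k).head
  | .gr, i => ¬ M.Halting (M.run x k).state ∧ (M.run x k).head < i
  | .gl, i => ¬ M.Halting (M.run x k).state ∧ i < (M.run x k).head
  | _, _ => False

/-- The model describing the first `n` steps of a computation along the points `a`. -/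
def val : M.Family → ℕ → Set (NonemptyInterval T)
  | .hdNext c, i => {I | ∃ k < n, I = pt (a (2 * k + 1)) ∧ M.Fact x k (.hd c) i}
  | .res c s, i => {I | ∃ k < n, I = pt (a (2 * k + 1)) ∧ M.Fact x k (.hd c) i ∧
      (M.run x k).tape i = s}
  | .both c s, i => {I | (∃ k ≤ n, I = pt (a (2 * k)) ∧ (M.run x k).tape i = s) ∨
      I.fst < I.snd ∧ ∃ k < n, I.snd = a (2 * k + 1) ∧ M.Fact x k (.hd c) i}
  | v, i => {I | ∃ k ≤ n, I = pt (a (2 * k)) ∧ M.Fact x k v i}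

def valuation (w : List Bool) : Set (NonemptyInterval T) :=
  {I | ∃ v i, w = M.name v i ∧ I ∈ M.val x n a v i}

@[simp] theorem holds_lit {v : M.Family} {i : ℕ} {I : NonemptyInterval T} :
    (M.lit v i).Holds (M.valuation x n a) I ↔ I ∈ M.val x n a v i := by
  refine ⟨?_, fun h => ⟨v, i, rfl, h⟩⟩
  rintro ⟨w, j, hw, h⟩
  obtain ⟨rfl, rfl⟩ := M.name_inj hw
  exact h

variable {x n a}

theorem imp_holds {ν : List Bool → Set (NonemptyInterval T)} {l l' : Literal}
    {I : NonemptyInterval T} (h : ∀ J, l.Holds ν J → l'.Holds ν J) :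
    (Formula.imp l l').Holds ν I := fun J hJ => h J (hJ l (List.mem_singleton_self l))

theorem imp_fact_holds {v w : M.Family} {i j : ℕ} {I : NonemptyInterval T}
    (hv : M.val x n a v i = {I | ∃ k ≤ n, I = pt (a (2 * k)) ∧ M.Fact x k v i})
    (hw : M.val x n a w j = {I | ∃ k ≤ n, I = pt (a (2 * k)) ∧ M.Fact x k w j})
    (h : ∀ k, M.Fact x k v i → M.Fact x k w j) :
    (Formula.imp (M.lit v i) (M.lit w j)).Holds (M.valuation x n a) I := by
  refine imp_holds fun J hJ => ?_
  rw [holds_lit, hw]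
  rw [holds_lit, hv] at hJ
  obtain ⟨k, hk, hJ, hf⟩ := hJ
  exact ⟨k, hk, hJ, h k hf⟩

theorem nextClause_holds {v w : M.Family} {i j : ℕ} {I : NonemptyInterval T}
    (hp : ∀ J ∈ M.val x n a v i, J.fst = J.snd)
    (h : ∀ t t', t ⋖ t' → pt t ∈ M.val x n a v i → pt t' ∈ M.val x n a w j) :
    (M.nextClause v i w j).Holds (M.valuation x n a) I := by
  refine imp_holds fun J hJ K hK => ?_
  rw [holds_lit]
  exact next_sound hp h J (fun J' hJ' => (M.holds_lit x n a).1 (hJ J' hJ')) K hK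

theorem pt_injective {t t' : T} (h : pt t = pt t') : t = t' := NonemptyInterval.pure_injective h

theorem next_hd_holds (ha : ∀ k < 2 * n, a k ⋖ a (k + 1)) (hn : M.Halting (M.run x n).state)
    {c : Option M.Q} (hc : ∀ q, c = some q → ¬ M.Halting q) {i : ℕ} {I : NonemptyInterval T} :
    (M.nextClause (.hd c) i (.hdNext c) i).Holds (M.valuation x n a) I := by
  refine M.nextClause_holds ?_ ?_
  · rintro J ⟨k, -, rfl, -⟩
    rfl
  · rintro t t' htt ⟨k, hk, ht, hf⟩
    obtain rfl := pt_injective ht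
    have hkn : k ≠ n := by
      rintro rfl
      cases c with
      | none => exact hf.1 hn
      | some q => exact hc q rfl (hf.1 ▸ hn)
    exact ⟨k, by omega, by rw [htt.unique_right (ha (2 * k) (by omega))], hf⟩

theorem next_res_holds (ha : ∀ k < 2 * n, a k ⋖ a (k + 1)) {c : Option M.Q} {s : M.S} {i j : ℕ}
    {I : NonemptyInterval T} {w : M.Family}
    (hw : M.val x n a w j = {I | ∃ k ≤ n, I = pt (a (2 * k)) ∧ M.Fact x k w j})
    (h : ∀ k, M.Fact x k (.hd c) i → (M.run x k).tape i = s → M.Fact x (k + 1) w j) :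
    (M.nextClause (.res c s) i w j).Holds (M.valuation x n a) I := by
  refine M.nextClause_holds ?_ ?_
  · rintro J ⟨k, -, rfl, -⟩
    rfl
  · rintro t t' htt ⟨k, hk, ht, hf, hs⟩
    obtain rfl := pt_injective ht
    rw [hw]
    exact ⟨k + 1, hk, by rw [htt.unique_right (ha (2 * k + 1) (by omega))]; rfl, h k hf hs⟩

theorem strictMono_chain {m : ℕ} (ha : ∀ k < m, a k ⋖ a (k + 1)) {j k : ℕ} (hjk : j < k)
    (hk : k ≤ m) : a j < a k := by
  induction k, hjk using Nat.le_induction with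
  | base => exact (ha j (by omega)).lt
  | succ k _ ih => exact (ih (by omega)).trans (ha k (by omega)).lt

theorem injective_chain {m : ℕ} (ha : ∀ k < m, a k ⋖ a (k + 1)) {j k : ℕ} (hj : j ≤ m)
    (hk : k ≤ m) (h : a j = a k) : j = k := by
  rcases lt_trichotomy j k with hlt | heq | hlt
  exacts [absurd h (strictMono_chain ha hlt hk).ne, heq,
    absurd h (strictMono_chain ha hlt hj).ne']

theorem andClauses_sat (hT : ∀ x : T, ¬ IsMax x → ∃ y, x ⋖ y)
    (ha : ∀ k < 2 * n, a k ⋖ a (k + 1)) {c : Option M.Q} {s : M.S} {i : ℕ}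
    {I : NonemptyInterval T} :
    ∀ ψ ∈ M.andClauses i c s, ψ.Holds (M.valuation x n a) I := by
  simp only [andClauses, List.forall_mem_cons]
  refine ⟨imp_holds fun J hJ => ?_, imp_holds fun J hJ K hK => ?_, imp_holds fun J hJ K hK => ?_,
    by simp⟩
  · rw [holds_lit] at hJ ⊢
    exact Or.inl hJ
  · rw [holds_lit] at hJ ⊢
    obtain ⟨k, hk, rfl, hf⟩ := hJ
    obtain ⟨h₁, h₂⟩ := hK
    have h₁' : K.fst < a (2 * k + 1) := h₁
    have h₂' : a (2 * k + 1) = K.snd := h₂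
    exact Or.inr ⟨h₁'.trans_eq h₂', k, hk, h₂'.symm, hf⟩
  · rw [holds_lit]
    refine and_sound (p := fun t => ∃ k ≤ n, t = a (2 * k) ∧ (M.run x k).tape i = s)
      (q := fun t => ∃ k < n, t = a (2 * k + 1) ∧ M.Fact x k (.hd c) i)
      hT ?_ ?_ ?_ ?_ J (fun J' hJ' => (M.holds_lit x n a).1 (hJ J' hJ')) K hK
    · rintro t (⟨k, hk, ht, h⟩ | ⟨h, -⟩)
      · exact ⟨k, hk, pt_injective ht, h⟩
      · exact absurd h (lt_irrefl t)
    · rintro I (⟨k, hk, rfl, -⟩ | ⟨-, h⟩) hI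
      · exact absurd hI (lt_irrefl (a (2 * k)))
      · exact h
    · rintro t v htv ⟨k, hk, rfl, -⟩ ⟨k', hk', rfl, -⟩
      have := injective_chain ha (by omega) (by omega)
        (htv.unique_right (ha (2 * k + 1) (by omega)))
      omega
    · rintro t v htv ⟨k, hk, rfl, h⟩ ⟨k', hk', rfl, hf⟩
      have hkn : k ≠ n := by
        rintro rfl
        exact (strictMono_chain ha (j := 2 * k' + 1) (k := 2 * k) (by omega) le_rfl).not_gt htv.lt
      have := injective_chain ha (by omega) (by omega)
        (htv.unique_right (ha (2 * k) (by omega)))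
      obtain rfl : k' = k := by omega
      exact ⟨k', hk', rfl, hf, h⟩

theorem headClauses_sat (ha : ∀ k < 2 * n, a k ⋖ a (k + 1)) (hn : (M.run x n).state = M.accept)
    {c : Option M.Q} {i : ℕ} {I : NonemptyInterval T} :
    ∀ ψ ∈ M.headClauses i c, ψ.Holds (M.valuation x n a) I := by
  have hn' : M.Halting (M.run x n).state := Or.inl hn
  cases c with
  | none =>
    simp only [headClauses, List.forall_mem_cons]
    refine ⟨M.next_hd_holds ha hn' (by simp), M.imp_fact_holds rfl rfl fun k h => ?_,
      M.imp_fact_holds rfl rfl fun k h => ?_, M.imp_fact_holds rfl rfl fun k h => ?_,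
      M.imp_fact_holds rfl rfl fun k h => ?_, by simp⟩
    · exact ⟨h.1, h.2.trans (Nat.lt_succ_self i)⟩
    · exact ⟨h.1, h.2.ne'⟩
    · exact ⟨h.1, (Nat.lt_succ_self i).trans h.2⟩
    · exact ⟨h.1, h.2.ne⟩
  | some q =>
    simp only [headClauses]
    split_ifs with h₁ h₂
    · simp only [List.forall_mem_cons]
      refine ⟨imp_holds fun J hJ => ?_, by simp⟩
      rw [holds_lit] at hJ
      obtain ⟨k, hk, -, hf⟩ := hJ
      have hh : M.Halting (M.run x k).state := Or.inr (hf.1.trans h₁)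
      rw [M.run_of_halting hh hk, hf.1, h₁] at hn
      exact M.accept_ne_reject hn.symm
    · simp
    · have hq : ¬ M.Halting q := by simp [Halting, h₁, h₂]
      simp only [List.forall_mem_cons]
      refine ⟨M.next_hd_holds ha hn' (by simpa using hq), fun J hJ => ?_,
        M.imp_fact_holds rfl rfl fun k h => ?_, M.imp_fact_holds rfl rfl fun k h => ?_, by simp⟩
      · have hJ₁ := hJ _ List.mem_cons_self
        have hJ₂ := hJ _ (List.mem_cons_of_mem _ List.mem_cons_self)
        rw [holds_lit] at hJ₁
        obtain ⟨k, hk, rfl, hf⟩ := hJ₁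
        have hkn : k ≠ n := by
          rintro rfl
          exact hq (hf.1 ▸ hn')
        have h₁ := ha (2 * k) (by omega)
        have h₂ := ha (2 * k + 1) (by omega)
        exact hJ₂ ⟨(a (2 * k), a (2 * k + 1)), h₁.le⟩ ⟨rfl, h₁.lt⟩
          ⟨(a (2 * k), a (2 * k + 1 + 1)), (h₁.lt.trans h₂.lt).le⟩ ⟨rfl, h₂.lt⟩
      · exact ⟨h.1 ▸ hq, h.2 ▸ Nat.lt_succ_self _⟩
      · exact ⟨h.1 ▸ hq, h.2 ▸ Nat.lt_succ_self _⟩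

theorem run_succ_of_fact {q : M.Q} (hq : ¬ M.Halting q) {k i : ℕ} {s : M.S}
    (hf : M.Fact x k (.hd (some q)) i) (hs : (M.run x k).tape i = s) :
    M.run x (k + 1) = match M.δ q s with
      | (q', .write s') => ⟨q', i, Function.update (M.run x k).tape i s'⟩
      | (q', .left) => ⟨q', i - 1, (M.run x k).tape⟩
      | (q', .right) => ⟨q', i + 1, (M.run x k).tape⟩ := by
  obtain ⟨rfl, rfl⟩ := hf
  subst hs
  rw [run_succ, M.step_of_not_halting hq]

theorem resClauses_sat (ha : ∀ k < 2 * n, a k ⋖ a (k + 1)) {c : Option M.Q} {s : M.S} {i : ℕ}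
    {I : NonemptyInterval T} :
    ∀ ψ ∈ M.resClauses i c s, ψ.Holds (M.valuation x n a) I := by
  cases c with
  | none =>
    simp only [resClauses, List.forall_mem_cons]
    refine ⟨M.next_res_holds ha rfl fun k hf hs => ?_, by simp⟩
    simp only [Fact, run_succ]
    rwa [M.step_tape_of_ne hf.2]
  | some q =>
    simp only [resClauses]
    split_ifs with hq
    · simp
    · have hstep := fun k i => M.run_succ_of_fact (x := x) (k := k) (s := s) (i := i) hq
      split <;> rename_i heq <;> simp only [heq] at hstep <;>
      simp only [List.forall_mem_cons] <;>
      refine ⟨M.next_res_holds ha rfl fun k hf hs => ?_, M.next_res_holds ha rfl fun k hf hs => ?_,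
        by simp⟩ <;> simp [Fact, hstep k _ hf hs, hs]

theorem leftmostClauses_sat (ha : ∀ k < 2 * n, a k ⋖ a (k + 1)) {q : M.Q} {s : M.S}
    {I : NonemptyInterval T} :
    ∀ ψ ∈ M.leftmostClauses q s, ψ.Holds (M.valuation x n a) I := by
  unfold leftmostClauses
  split_ifs with hq
  · simp
  · split
    · rename_i heq
      simp only [List.forall_mem_cons]
      refine ⟨M.next_res_holds ha rfl fun k hf hs => ?_, by simp⟩
      have hstep := M.run_succ_of_fact hq hf hs
      simp only [heq] at hstep
      simp [Fact, hstep]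
    · simp

theorem formula_sat (hT : ∀ x : T, ¬ IsMax x → ∃ y, x ⋖ y)
    (ha : ∀ k < 2 * n, a k ⋖ a (k + 1)) (hn : (M.run x n).state = M.accept) (N : ℕ) :
    (M.formula (M.initial x).tape N).Holds (M.valuation x n a) (pt (a 0)) := by
  refine Formula.holds_conjs.2 ⟨M.forall_mem_formula _ _ (fun i => ?_)
    (fun i c => M.headClauses_sat ha hn) (fun i c s => M.andClauses_sat hT ha)
    (fun i c s => M.resClauses_sat ha) ?_ (fun q s => M.leftmostClauses_sat ha), ?_⟩
  · exact (M.holds_lit x n a).2 ⟨0, Nat.zero_le n, rfl, rfl⟩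
  · exact (M.holds_lit x n a).2 ⟨0, Nat.zero_le n, rfl, rfl, rfl⟩
  · rintro J ⟨h₁, h₂⟩
    exact absurd (h₁.le.trans J.fst_le_snd) h₂.not_ge

end Sat

end TM

/-! ### Chains in discrete orders -/

theorem exists_chain_up {T : Type u} [LinearOrder T] (hT : ∀ x : T, ¬ IsMax x → ∃ y, x ⋖ y)
    (m : ℕ) {x : T} (hx : (Set.Ioi x).Infinite) :
    ∃ a : ℕ → T, a 0 = x ∧ ∀ k < m, a k ⋖ a (k + 1) := by
  induction m generalizing x with
  | zero => exact ⟨fun _ => x, rfl, by simp⟩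
  | succ m ih =>
    obtain ⟨z, hz⟩ := hx.nonempty
    obtain ⟨y, hy⟩ := hT x (not_isMax_of_lt hz)
    have hyi : (Set.Ioi y).Infinite := by
      intro hfin
      refine hx ((hfin.insert y).subset fun w hw => ?_)
      rcases (hy.ge_of_gt hw).eq_or_lt with rfl | h
      exacts [Set.mem_insert _ _, Set.mem_insert_of_mem _ h]
    obtain ⟨a, ha₀, ha⟩ := ih hyi
    refine ⟨fun k => k.casesOn x a, rfl, fun k hk => ?_⟩
    cases k with
    | zero => exact (congrArg (x ⋖ ·) ha₀).mpr hy
    | succ k => exact ha k (by omega)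

theorem IsDiscreteOrder.exists_chain {T : Type u} [LinearOrder T] [Infinite T]
    (hT : IsDiscreteOrder T) (m : ℕ) : ∃ a : ℕ → T, ∀ k < m, a k ⋖ a (k + 1) := by
  obtain ⟨x⟩ : Nonempty T := inferInstance
  by_cases hx : (Set.Ioi x).Infinite
  · obtain ⟨a, -, ha⟩ := exists_chain_up hT.1 m hx
    exact ⟨a, ha⟩
  · have hx' : (Set.Iio x).Infinite := by
      intro hfin
      refine Set.infinite_univ (α := T) (((Set.not_infinite.1 hx).union
        (hfin.insert x)).subset fun y _ => ?_)
      rcases lt_trichotomy x y with h | h | h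
      exacts [Or.inl h, Or.inr (Or.inl h.symm), Or.inr (Or.inr h)]
    obtain ⟨a, -, ha⟩ := exists_chain_up (T := Tᵒᵈ) (x := OrderDual.toDual x) (fun y hy => by
      obtain ⟨z, hz⟩ := hT.2 (OrderDual.ofDual y) hy
      exact ⟨OrderDual.toDual z, hz.toDual⟩) m hx'
    refine ⟨fun k => OrderDual.ofDual (a (m - k)), fun k hk => ?_⟩
    have h := (ha (m - (k + 1)) (by omega)).ofDual
    rwa [show m - (k + 1) + 1 = m - k by omega] at h

theorem isDiscreteOrder_of_finite (T : Type u) [LinearOrder T] [Finite T] : IsDiscreteOrder T :=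
  ⟨fun _ h => exists_covBy_of_wellFoundedLT h, fun _ h => exists_covBy_of_wellFoundedGT h⟩

theorem exists_finite_chain (m : ℕ) : ∃ T : LinOrd.{u}, Finite T ∧
    ∃ a : ℕ → T, ∀ k < m, a k ⋖ a (k + 1) := by
  have hlt : ∀ p q : ULift.{u} (Fin (m + 1)), p < q ↔ (p.down : ℕ) < q.down := fun _ _ => Iff.rfl
  refine ⟨LinOrd.of (ULift.{u} (Fin (m + 1))), inferInstanceAs (Finite (ULift (Fin (m + 1)))),
    fun k => ULift.up (Fin.ofNat (m + 1) k), fun k hk => ?_⟩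
  have h₁ : k % (m + 1) = k := Nat.mod_eq_of_lt (by omega)
  have h₂ : (k + 1) % (m + 1) = k + 1 := Nat.mod_eq_of_lt (by omega)
  refine ⟨(hlt _ _).2 ?_, fun c hc hc' => ?_⟩
  · simp [h₁, h₂]
  · have h₃ := (hlt _ _).1 hc
    have h₄ := (hlt _ _).1 hc'
    simp only [Fin.val_ofNat, h₁, h₂] at h₃ h₄
    omega

end HSLogic

namespace HSLogic

/-! ### A language of stack programs -/

/-- Programs over stacks indexed by `K`. The program `loop k b` pops elements `a` from the stack
`k`, running `b a` for each of them, until it finds the stack empty. -/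
inductive Prog {K : Type} (Γ : K → Type) : Type
  | skip : Prog Γ
  | push (k : K) (a : Γ k) : Prog Γ
  | seq (p q : Prog Γ) : Prog Γ
  | loop (k : K) (b : Γ k → Prog Γ) : Prog Γ

namespace Prog

open Turing

variable {K : Type} {Γ : K → Type}

/-- The control points of a program. -/
def Pos : Prog Γ → Type
  | skip => Unit
  | push _ _ => Unit
  | seq p q => p.Pos ⊕ q.Pos
  | loop k b => Option (Σ a : Γ k, (b a).Pos)

theorem finite_pos [∀ k, Finite (Γ k)] (p : Prog Γ) : Finite p.Pos := by
  induction p with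
  | skip => exact inferInstanceAs (Finite Unit)
  | push k a => exact inferInstanceAs (Finite Unit)
  | seq p q ihp ihq => exact inferInstanceAs (Finite (p.Pos ⊕ q.Pos))
  | loop k b ih => exact inferInstanceAs (Finite (Option (Σ a : Γ k, (b a).Pos)))

def entry : (p : Prog Γ) → p.Pos
  | skip => ()
  | push _ _ => ()
  | seq p _ => Sum.inl p.entry
  | loop _ _ => none

variable [DecidableEq K]

/-- The statement at each control point, where `emb` embeds the control points into the labels of
a machine and `exit` is the label to go to in the end. The register keeps the last element popped
from each stack. -/
def code {Λ : Type} : (p : Prog Γ) → (p.Pos → Λ) → Λ → p.Pos → TM2.Stmt Γ Λ (∀ k, Option (Γ k))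
  | skip, _, exit, _ => .goto fun _ => exit
  | push k a, _, exit, _ => .push k (fun _ => a) (.goto fun _ => exit)
  | seq p q, emb, exit, x => match x with
    | .inl y => p.code (fun z => emb (.inl z)) (emb (.inr q.entry)) y
    | .inr y => q.code (fun z => emb (.inr z)) exit y
  | loop k b, emb, exit, x => match x with
    | none => .pop k (fun v o => Function.update v k o) (.goto fun v => match v k with
      | none => exit
      | some a => emb (some ⟨a, (b a).entry⟩))
    | some ⟨a, y⟩ => (b a).code (fun z => emb (some ⟨a, z⟩)) (emb none) y

/-- `p.Exec S t S'`: the program `p` leads from the stacks `S` to the stacks `S'` in at most `t`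
steps. -/
inductive Exec : Prog Γ → (∀ k, List (Γ k)) → ℕ → (∀ k, List (Γ k)) → Prop
  | skip (S) : Exec skip S 1 S
  | push (k a S) : Exec (push k a) S 1 (Function.update S k (a :: S k))
  | seq {p q S t S' t' S''} : Exec p S t S' → Exec q S' t' S'' → Exec (seq p q) S (t + t') S''
  | loop_nil {k b S} : S k = [] → Exec (loop k b) S 1 S
  | loop_cons {k b S a l t S' t' S''} : S k = a :: l → Exec (b a) (Function.update S k l) t S' →
      Exec (loop k b) S' t' S'' → Exec (loop k b) S (1 + t + t') S''
  | mono {p S t S' t'} : Exec p S t S' → t ≤ t' → Exec p S t' S'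

theorem Exec.of_eq {p : Prog Γ} {S S₁ S' : ∀ k, List (Γ k)} {t : ℕ} (h : S = S₁)
    (h' : p.Exec S₁ t S') : p.Exec S t S' := h ▸ h'

theorem Exec.push_eq {k : K} {a : Γ k} {S S' : ∀ k, List (Γ k)}
    (h : Function.update S k (a :: S k) = S') : (Prog.push k a).Exec S 1 S' :=
  h ▸ Exec.push k a S

theorem Exec.sim {Λ : Type} {m : Λ → TM2.Stmt Γ Λ (∀ k, Option (Γ k))} {p : Prog Γ}
    {S S' : ∀ k, List (Γ k)} {T : ℕ} (h : p.Exec S T S') :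
    ∀ (emb : p.Pos → Λ) (exit : Λ), (∀ x, m (emb x) = p.code emb exit x) → ∀ v, ∃ t ≤ T, ∃ v',
      (flip bind (TM2.step m))^[t] (some ⟨some (emb p.entry), v, S⟩) =
        some ⟨some exit, v', S'⟩ := by
  induction h with
  | skip S =>
    intro emb exit hm v
    refine ⟨1, le_rfl, v, ?_⟩
    simp [flip, hm, code]
  | push k a S =>
    intro emb exit hm v
    refine ⟨1, le_rfl, v, ?_⟩
    simp [flip, hm, code]
  | @seq p q S t S' t' S'' _ _ ih₁ ih₂ =>
    intro emb exit hm v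
    obtain ⟨t₁, h₁, v₁, e₁⟩ := ih₁ (fun z => emb (.inl z)) (emb (.inr q.entry))
      (fun x => hm (.inl x)) v
    obtain ⟨t₂, h₂, v₂, e₂⟩ := ih₂ (fun z => emb (.inr z)) exit (fun x => hm (.inr x)) v₁
    refine ⟨t₂ + t₁, by omega, v₂, ?_⟩
    rw [Function.iterate_add_apply]
    exact (congrArg _ e₁).trans e₂
  | @loop_nil k b S hS =>
    intro emb exit hm v
    refine ⟨1, le_rfl, Function.update v k none, ?_⟩
    have hS' : Function.update S k [] = S := by rw [← hS, Function.update_eq_self]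
    have hm' : m (emb none) = _ := hm none
    simp [flip, hm', code, entry, hS, hS']
  | @loop_cons k b S a l t S' t' S'' hS _ _ ih₁ ih₂ =>
    intro emb exit hm v
    obtain ⟨t₁, h₁, v₁, e₁⟩ := ih₁ (fun z => emb (some ⟨a, z⟩)) (emb none)
      (fun x => hm (some ⟨a, x⟩)) (Function.update v k (some a))
    obtain ⟨t₂, h₂, v₂, e₂⟩ := ih₂ emb exit hm v₁
    refine ⟨t₂ + (t₁ + 1), by omega, v₂, ?_⟩
    rw [Function.iterate_add_apply, Function.iterate_add_apply]
    have e₀ : (flip bind (TM2.step m))^[1] (some ⟨some (emb (loop k b).entry), v, S⟩) =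
        some ⟨some (emb (some ⟨a, (b a).entry⟩)), Function.update v k (some a),
          Function.update S k l⟩ := by
      have hm' : m (emb none) = _ := hm none
      simp [flip, hm', code, entry, hS]
    rw [e₀]
    exact (congrArg _ e₁).trans e₂
  | mono _ hle ih =>
    intro emb exit hm v
    obtain ⟨t, ht, h⟩ := ih emb exit hm v
    exact ⟨t, ht.trans hle, h⟩

/-- The machine running a program. -/
noncomputable def machine [Fintype K] [∀ k, Finite (Γ k)] (p : Prog Γ) (k₀ k₁ : K) : FinTM2 where
  K := K
  k₀ := k₀
  k₁ := k₁
  Γ := Γ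
  Λ := Option p.Pos
  main := some p.entry
  ΛFin := haveI := p.finite_pos; Fintype.ofFinite _
  σ := ∀ k, Option (Γ k)
  initialState := fun _ => none
  σFin := Fintype.ofFinite _
  Γk₀Fin := Fintype.ofFinite _
  m
    | none => .load (fun _ _ => none) .halt
    | some x => p.code some none x

theorem Exec.machine_evals [Fintype K] [∀ k, Finite (Γ k)] {p : Prog Γ} (k₀ k₁ : K)
    {S S' : ∀ k, List (Γ k)} {T : ℕ} (h : p.Exec S T S') :
    Nonempty (StateTransition.EvalsToInTime (p.machine k₀ k₁).step
      ⟨some (some p.entry), fun _ => none, S⟩ (some ⟨none, fun _ => none, S'⟩) (T + 1)) := by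
  obtain ⟨t, ht, v', e⟩ := h.sim (m := (p.machine k₀ k₁).m) some none (fun _ => rfl) fun _ => none
  refine ⟨⟨⟨t + 1, ?_⟩, Nat.succ_le_succ ht⟩⟩
  rw [Function.iterate_succ_apply']
  exact congrArg (flip bind (TM2.step (p.machine k₀ k₁).m)) e

theorem Exec.loop_count {k : K} {b : Γ k → Prog Γ} (S : ℕ → ∀ k, List (Γ k)) (T n : ℕ)
    (h0 : S 0 k = []) (h : ∀ j < n, ∃ a l, S (j + 1) k = a :: l ∧
      (b a).Exec (Function.update (S (j + 1)) k l) T (S j)) :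
    (loop k b).Exec (S n) (n * (T + 1) + 1) (S 0) := by
  induction n with
  | zero => exact (Exec.loop_nil h0).mono (by omega)
  | succ n ih =>
    obtain ⟨a, l, hS, hb⟩ := h n n.lt_succ_self
    exact (Exec.loop_cons hS hb (ih fun j hj => h j (by omega))).mono (by
      rw [Nat.succ_mul]; omega)

end Prog

/-! ### Writing instances of templates -/

/-- A template is a word with placeholders `none` for a number in unary, written with `u`. -/
def instantiate {B : Type} (u : B) (w : List (Option B)) (i : ℕ) : List B :=
  w.flatMap fun o => o.elim (List.replicate i u) fun b => [b]

/-- The stacks: input, output, and six counters. -/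
inductive Stack : Type
  | inp | out | idx | idx' | len | len' | num | num'
  deriving DecidableEq

namespace Stack

instance : Fintype Stack :=
  ⟨{inp, out, idx, idx', len, len', num, num'}, fun k => by cases k <;> simp⟩

variable (A B : Type)

def Alph : Stack → Type
  | inp => A
  | out => B
  | _ => Unit

instance [Finite A] [Finite B] (k : Stack) : Finite (Alph A B k) := by
  cases k
  exacts [inferInstanceAs (Finite A), inferInstanceAs (Finite B), inferInstanceAs (Finite Unit),
    inferInstanceAs (Finite Unit), inferInstanceAs (Finite Unit), inferInstanceAs (Finite Unit),
    inferInstanceAs (Finite Unit), inferInstanceAs (Finite Unit)]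

variable {A B}

def contents (x : List A) (y : List B) (i i' l l' n n' : ℕ) : ∀ k, List (Alph A B k)
  | inp => x
  | out => y
  | idx => List.replicate i ()
  | idx' => List.replicate i' ()
  | len => List.replicate l ()
  | len' => List.replicate l' ()
  | num => List.replicate n ()
  | num' => List.replicate n' ()

variable {x : List A} {y : List B} {i i' l l' n n' : ℕ}

open Function (update)

theorem update_inp (x' : List A) : update (contents x y i i' l l' n n') inp x' =
    contents x' y i i' l l' n n' := by
  funext k; cases k <;> rfl

theorem update_out (y' : List B) : update (contents x y i i' l l' n n') out y' =
    contents x y' i i' l l' n n' := by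
  funext k; cases k <;> rfl

theorem update_idx (m : ℕ) : update (contents x y i i' l l' n n') idx (List.replicate m ()) =
    contents x y m i' l l' n n' := by
  funext k; cases k <;> rfl

theorem update_idx' (m : ℕ) : update (contents x y i i' l l' n n') idx' (List.replicate m ()) =
    contents x y i m l l' n n' := by
  funext k; cases k <;> rfl

theorem update_len (m : ℕ) : update (contents x y i i' l l' n n') len (List.replicate m ()) =
    contents x y i i' m l' n n' := by
  funext k; cases k <;> rfl

theorem update_len' (m : ℕ) : update (contents x y i i' l l' n n') len' (List.replicate m ()) =
    contents x y i i' l m n n' := by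
  funext k; cases k <;> rfl

theorem update_num (m : ℕ) : update (contents x y i i' l l' n n') num (List.replicate m ()) =
    contents x y i i' l l' m n' := by
  funext k; cases k <;> rfl

theorem update_num' (m : ℕ) : update (contents x y i i' l l' n n') num' (List.replicate m ()) =
    contents x y i i' l l' n m := by
  funext k; cases k <;> rfl

open Prog

theorem push_out (b : B) : (Prog.push (Γ := Alph A B) out b).Exec (contents x y i i' l l' n n') 1
    (contents x (b :: y) i i' l l' n n') := by
  exact Exec.push_eq (update_out _)

theorem push_idx : (Prog.push (Γ := Alph A B) idx ()).Exec (contents x y i i' l l' n n') 1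
    (contents x y (i + 1) i' l l' n n') := by
  exact Exec.push_eq (update_idx (i + 1))

theorem push_idx' : (Prog.push (Γ := Alph A B) idx' ()).Exec (contents x y i i' l l' n n') 1
    (contents x y i (i' + 1) l l' n n') := by
  exact Exec.push_eq (update_idx' (i' + 1))

theorem push_len : (Prog.push (Γ := Alph A B) len ()).Exec (contents x y i i' l l' n n') 1
    (contents x y i i' (l + 1) l' n n') := by
  exact Exec.push_eq (update_len (l + 1))

theorem push_len' : (Prog.push (Γ := Alph A B) len' ()).Exec (contents x y i i' l l' n n') 1
    (contents x y i i' l (l' + 1) n n') := by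
  exact Exec.push_eq (update_len' (l' + 1))

theorem push_num : (Prog.push (Γ := Alph A B) num ()).Exec (contents x y i i' l l' n n') 1
    (contents x y i i' l l' (n + 1) n') := by
  exact Exec.push_eq (update_num (n + 1))

theorem push_num' : (Prog.push (Γ := Alph A B) num' ()).Exec (contents x y i i' l l' n n') 1
    (contents x y i i' l l' n (n' + 1)) := by
  exact Exec.push_eq (update_num' (n' + 1))

/-- Write one symbol of a template. -/
def emitTok (u : B) : Option B → Prog (Alph A B)
  | some b => .push out b
  | none => .seq (.loop idx fun _ => .seq (.push out u) (.push idx' ()))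
      (.loop idx' fun _ => .push idx ())

theorem emitTok_exec (u : B) (o : Option B) :
    (emitTok (A := A) u o).Exec (contents x y i 0 l l' n n') (5 * i + 2)
      (contents x (o.elim (List.replicate i u) (fun b => [b]) ++ y) i 0 l l' n n') := by
  cases o with
  | some b => exact (push_out b).mono (by omega)
  | none =>
    refine Exec.mono (.seq (S' := contents x (List.replicate i u ++ y) 0 i l l' n n')
      (t := i * (2 + 1) + 1) (t' := i * (1 + 1) + 1) ?_ ?_) (by omega)
    · have h := Exec.loop_count (k := idx)
        (b := fun _ => .seq (.push (Γ := Alph A B) out u) (.push idx' ()))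
        (fun j => contents x (List.replicate (i - j) u ++ y) j (i - j) l l' n n') 2 i rfl
        fun j hj => ⟨(), List.replicate j (), rfl, by
          rw [update_idx, show i - j = i - (j + 1) + 1 by omega]
          exact .seq (push_out u) push_idx'⟩
      simpa using h
    · have h := Exec.loop_count (k := idx') (b := fun _ => .push (Γ := Alph A B) idx ())
        (fun j => contents x (List.replicate i u ++ y) (i - j) j l l' n n') 1 i rfl
        fun j hj => ⟨(), List.replicate j (), rfl, by
          rw [update_idx', show i - j = i - (j + 1) + 1 by omega]
          exact push_idx⟩
      simpa using h

/-- Write the instance of a template for the number on the stack `idx`. -/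
def emit (u : B) : List (Option B) → Prog (Alph A B)
  | [] => .skip
  | o :: w => .seq (emit u w) (emitTok u o)

theorem emit_exec (u : B) (w : List (Option B)) :
    (emit (A := A) u w).Exec (contents x y i 0 l l' n n') (w.length * (5 * i + 2) + 1)
      (contents x (instantiate u w i ++ y) i 0 l l' n n') := by
  induction w with
  | nil => exact (Exec.skip _).mono (by simp)
  | cons o w ih =>
    have h := (ih.seq (emitTok_exec u o)).mono (t' := (w.length + 1) * (5 * i + 2) + 1)
      (le_of_eq (by ring))
    simpa [instantiate, List.append_assoc, emit] using h

/-- Multiply the number on the stack `num` by that on `len`. -/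
def mul : Prog (Alph A B) :=
  .seq (.loop num fun _ => .seq (.loop len fun _ => .seq (.push num' ()) (.push len' ()))
    (.loop len' fun _ => .push len ())) (.loop num' fun _ => .push num ())

theorem mul_exec : (mul (A := A) (B := B)).Exec (contents x y i i' l 0 n 0) (n * (7 * l + 3) + 2)
    (contents x y i i' l 0 (n * l) 0) := by
  have h₁ : ∀ j r, (Prog.loop (Γ := Alph A B) len fun _ =>
      .seq (.push num' ()) (.push len' ())).Exec (contents x y i i' l 0 j r) (l * (2 + 1) + 1)
      (contents x y i i' 0 l j (r + l)) := fun j r => by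
    have h := Exec.loop_count (k := len)
      (b := fun _ => .seq (.push (Γ := Alph A B) num' ()) (.push len' ()))
      (fun s => contents x y i i' s (l - s) j (r + (l - s))) 2 l rfl
      fun s hs => ⟨(), List.replicate s (), rfl, by
        rw [update_len, show l - s = l - (s + 1) + 1 by omega]
        exact .seq push_num' push_len'⟩
    simpa using h
  have h₂ : ∀ j r, (Prog.loop (Γ := Alph A B) len' fun _ => .push len ()).Exec
      (contents x y i i' 0 l j r) (l * (1 + 1) + 1) (contents x y i i' l 0 j r) := fun j r => by
    have h := Exec.loop_count (k := len') (b := fun _ => .push (Γ := Alph A B) len ())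
      (fun s => contents x y i i' (l - s) s j r) 1 l rfl
      fun s hs => ⟨(), List.replicate s (), rfl, by
        rw [update_len', show l - s = l - (s + 1) + 1 by omega]
        exact push_len⟩
    simpa using h
  refine Exec.mono (.seq (S' := contents x y i i' l 0 0 (n * l))
    (t := n * (l * (2 + 1) + 1 + (l * (1 + 1) + 1) + 1) + 1) (t' := n * l * (1 + 1) + 1) ?_ ?_)
    (le_of_eq (by ring))
  · have h := Exec.loop_count (k := num)
      (b := fun _ => .seq (.loop (Γ := Alph A B) len fun _ => .seq (.push num' ()) (.push len' ()))
        (.loop len' fun _ => .push len ()))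
      (fun s => contents x y i i' l 0 s ((n - s) * l)) (l * (2 + 1) + 1 + (l * (1 + 1) + 1)) n rfl
      fun s hs => ⟨(), List.replicate s (), rfl, by
        rw [update_num, show n - s = n - (s + 1) + 1 by omega, Nat.succ_mul]
        exact .seq (h₁ _ _) (h₂ _ _)⟩
    simpa using h
  · have h := Exec.loop_count (k := num') (b := fun _ => .push (Γ := Alph A B) num ())
      (fun s => contents x y i i' l 0 (n * l - s) s) 1 (n * l) rfl
      fun s hs => ⟨(), List.replicate s (), rfl, by
        rw [update_num', show n * l - s = n * l - (s + 1) + 1 by omega]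
        exact push_num⟩
    simpa using h

def repeated (p : Prog (Alph A B)) : ℕ → Prog (Alph A B)
  | 0 => .skip
  | c + 1 => .seq (repeated p c) p

theorem pad_exec (c : ℕ) : (repeated (.push (Γ := Alph A B) len ()) c).Exec
    (contents x y i i' l l' n n') (c + 1) (contents x y i i' (l + c) l' n n') := by
  induction c with
  | zero => exact Exec.skip _
  | succ c ih => exact (ih.seq push_len).mono (by omega)

theorem pow_exec (c : ℕ) (hl : 0 < l) : (repeated (mul (A := A) (B := B)) c).Exec
    (contents x y i i' l 0 1 0) (c * (l ^ c * (7 * l + 3) + 2) + 1)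
    (contents x y i i' l 0 (l ^ c) 0) := by
  induction c with
  | zero => exact (Exec.skip _).mono (by simp)
  | succ c ih =>
    rw [pow_succ]
    refine (ih.seq mul_exec).mono ?_
    have h : l ^ c * (7 * l + 3) ≤ l ^ c * l * (7 * l + 3) :=
      Nat.mul_le_mul_right _ (Nat.le_mul_of_pos_right _ hl)
    have h' : c * (l ^ c * (7 * l + 3) + 2) ≤ c * (l ^ c * l * (7 * l + 3) + 2) :=
      Nat.mul_le_mul_left _ (by omega)
    calc _ ≤ c * (l ^ c * l * (7 * l + 3) + 2) + 1 + (l ^ c * l * (7 * l + 3) + 2) := by omega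
      _ = _ := by ring

end Stack

end HSLogic

namespace HSLogic
namespace Stack

open Prog Turing

/-- The instances of templates for the numbers below `N`, in decreasing order; which template is
used for `i` depends on the symbol at position `i` of the input. -/
def blocks {A B : Type} (u : B) (blk : Option A → List (Option B)) (x : List A) (N : ℕ) : List B :=
  (List.range N).reverse.flatMap fun i => instantiate u (blk x[i]?) i

variable {A B : Type} (u : B) (blk : Option A → List (Option B)) (base : List (Option B)) (c d : ℕ)

theorem blocks_succ (x : List A) (N : ℕ) :
    blocks u blk x (N + 1) = instantiate u (blk x[N]?) N ++ blocks u blk x N := by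
  simp [blocks, List.range_succ]

/-- Write a block and increment the index. -/
def writeBlock (o : Option A) : Prog (Alph A B) := .seq (emit u (blk o)) (.push idx ())

def program : Prog (Alph A B) :=
  .seq (emit u base) <| .seq (.loop inp fun a => .seq (writeBlock u blk (some a)) (.push len ())) <|
  .seq (repeated (.push len ()) c) <| .seq (.push num ()) <| .seq (repeated mul d) <|
  .seq (.loop num fun _ => writeBlock u blk none) <|
  .seq (.loop idx fun _ => .skip) (.loop len fun _ => .skip)

def programTime (L n : ℕ) : ℕ :=
  base.length * 2 + 1 + (n * (L * (5 * n + 2) + 4) + 1 + (c + 1 + (1 +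
    (d * ((n + c) ^ d * (7 * (n + c) + 3) + 2) + 1 +
    ((n + c) ^ d * (L * (5 * (n + (n + c) ^ d) + 2) + 3) + 1 +
    ((n + (n + c) ^ d) * 2 + 1 + ((n + c) * 2 + 1)))))))

variable {u blk base c d}

theorem writeBlock_exec {L : ℕ} (hL : ∀ o, (blk o).length ≤ L) {x₀ x : List A} {y : List B}
    {i m l l' n n' : ℕ} (him : i ≤ m) :
    (writeBlock u blk x₀[i]?).Exec (contents x (blocks u blk x₀ i ++ y) i 0 l l' n n')
      (L * (5 * m + 2) + 2) (contents x (blocks u blk x₀ (i + 1) ++ y) (i + 1) 0 l l' n n') := by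
  rw [blocks_succ, List.append_assoc]
  refine ((emit_exec u (blk x₀[i]?)).seq push_idx).mono ?_
  have h : (blk x₀[i]?).length * (5 * i + 2) ≤ L * (5 * m + 2) :=
    Nat.mul_le_mul (hL _) (by omega)
  omega

theorem program_exec {L : ℕ} (hL : ∀ o, (blk o).length ≤ L) (hc : 0 < c) (x : List A) :
    (program u blk base c d).Exec (contents x [] 0 0 0 0 0 0) (programTime base c d L x.length)
      (contents [] (blocks u blk x (x.length + (x.length + c) ^ d) ++ instantiate u base 0)
        0 0 0 0 0 0) := by
  set n := x.length with hn
  set y := instantiate u base 0 with hy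
  set N := (n + c) ^ d with hN
  refine .seq (S' := contents x y 0 0 0 0 0 0) ?_ <|
    .seq (S' := contents [] (blocks u blk x n ++ y) n 0 n 0 0 0) ?_ <|
    .seq (pad_exec c) <| .seq push_num <| .seq (pow_exec d (by omega)) <|
    .seq (S' := contents [] (blocks u blk x (n + N) ++ y) (n + N) 0 (n + c) 0 0 0) ?_ <|
    .seq (S' := contents [] (blocks u blk x (n + N) ++ y) 0 0 (n + c) 0 0 0) ?_ ?_
  · simpa using emit_exec (A := A) u base (x := x) (y := []) (i := 0)
  · have h := Exec.loop_count (k := inp)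
      (b := fun a => .seq (writeBlock u blk (some a)) (.push len ()))
      (fun j => contents (x.drop (n - j)) (blocks u blk x (n - j) ++ y) (n - j) 0 (n - j) 0 0 0)
      (L * (5 * n + 2) + 3) n (by rw [Nat.sub_zero, hn, List.drop_length]; rfl) fun j hj => by
        have hj' : n - (j + 1) < x.length := by omega
        refine ⟨x[n - (j + 1)], x.drop (n - j), ?_, ?_⟩
        · change x.drop (n - (j + 1)) = _
          rw [List.drop_eq_getElem_cons hj', show n - j = n - (j + 1) + 1 by omega]
          rfl
        · refine Exec.of_eq (update_inp _) ?_
          rw [show n - j = n - (j + 1) + 1 by omega,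
            ← List.getElem?_eq_getElem hj']
          exact (Exec.seq (writeBlock_exec hL (Nat.sub_le _ _)) push_len).mono le_rfl
    simpa [hn, blocks] using h
  · have h := Exec.loop_count (k := num) (b := fun _ => writeBlock u blk none)
      (fun j => contents [] (blocks u blk x (n + (N - j)) ++ y) (n + (N - j)) 0 (n + c) 0 j 0)
      (L * (5 * (n + N) + 2) + 2) N rfl fun j hj => ⟨(), List.replicate j (), rfl, by
        rw [update_num, show n + (N - j) = n + (N - (j + 1)) + 1 by omega,
          ← List.getElem?_eq_none (show x.length ≤ n + (N - (j + 1)) by omega)]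
        exact writeBlock_exec hL (by omega)⟩
    simpa using h
  · exact Exec.loop_count (k := idx) (b := fun _ => .skip)
      (fun j => contents [] (blocks u blk x (n + N) ++ y) j 0 (n + c) 0 0 0) 1 (n + N) rfl
      fun j hj => ⟨(), List.replicate j (), rfl, by
        rw [update_idx]
        exact Exec.skip _⟩
  · exact Exec.loop_count (k := len) (b := fun _ => .skip)
      (fun j => contents [] (blocks u blk x (n + N) ++ y) 0 0 j 0 0 0) 1 (n + c) rfl
      fun j hj => ⟨(), List.replicate j (), rfl, by
        rw [update_len]
        exact Exec.skip _⟩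

theorem initList_machine [Finite A] [Finite B] (p : Prog (Alph A B)) (x : List A) :
    initList (p.machine inp out) x =
      ⟨some (some p.entry), fun _ => none, contents x [] 0 0 0 0 0 0⟩ := by
  unfold initList
  congr 1
  funext k
  cases k <;> rfl

theorem haltList_machine [Finite A] [Finite B] (p : Prog (Alph A B)) (y : List B) :
    haltList (p.machine inp out) y = ⟨none, fun _ => none, contents [] y 0 0 0 0 0 0⟩ := by
  unfold haltList
  congr 1
  funext k
  cases k <;> rfl

/-- Writing templates for polynomially many numbers takes polynomial time. -/
theorem polyTime_blocks [Finite A] [Finite B] (hc : 0 < c) :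
    Nonempty (TM2ComputableInPolyTime (id : List A → List A) (id : List B → List B) fun x =>
      blocks u blk x (x.length + (x.length + c) ^ d) ++ instantiate u base 0) := by
  obtain ⟨L, hL⟩ := Finite.exists_le fun o => (blk o).length
  open Polynomial in
  refine ⟨{
    tm := (program u blk base c d).machine inp out
    inputAlphabet := Equiv.refl A
    outputAlphabet := Equiv.refl B
    time := C (base.length * 2 + 1) + (X * (C L * (5 * X + 2) + 4) + 1 + (C (c + 1) + (1 +
      (C d * ((X + C c) ^ d * (7 * (X + C c) + 3) + 2) + 1 +
      ((X + C c) ^ d * (C L * (5 * (X + (X + C c) ^ d) + 2) + 3) + 1 +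
      ((X + (X + C c) ^ d) * 2 + 1 + ((X + C c) * 2 + 1))))))) + 1
    outputsFun := fun x => ?_ }⟩
  refine Classical.choice ?_
  have h := (program_exec (u := u) (base := base) (d := d) hL hc x).machine_evals inp out
  have hx : List.map (Equiv.refl A).invFun x = x := by simp
  have hy : ∀ y : List B, List.map (Equiv.refl B).invFun y = y := fun y => by simp
  rw [← initList_machine, ← haltList_machine] at h
  simp only [TM2OutputsInTime, id]
  convert! h using 2
  · exact congrArg _ hx
  · exact congrArg (fun z => some (haltList _ z)) (hy _)
  · simp [programTime]

end Stack
end HSLogic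

namespace HSLogic

theorem exists_eval_le_pow (p : Polynomial ℕ) :
    ∃ c d : ℕ, 0 < c ∧ ∀ n, p.eval n ≤ (n + c) ^ d := by
  induction p using Polynomial.induction_on' with
  | monomial k a =>
    refine ⟨a + 1, k + 1, a.succ_pos, fun n => ?_⟩
    rw [Polynomial.eval_monomial, pow_succ, mul_comm]
    exact Nat.mul_le_mul (Nat.pow_le_pow_left (by omega) k) (by omega)
  | add p q hp hq =>
    obtain ⟨c₁, d₁, h₁, hp⟩ := hp
    obtain ⟨c₂, d₂, h₂, hq⟩ := hq
    refine ⟨c₁ + c₂, d₁ + d₂ + 1, by omega, fun n => ?_⟩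
    have hp' : p.eval n ≤ (n + (c₁ + c₂)) ^ (d₁ + d₂) := (hp n).trans
      ((Nat.pow_le_pow_left (by omega) _).trans (Nat.pow_le_pow_right (by omega) (by omega)))
    have hq' : q.eval n ≤ (n + (c₁ + c₂)) ^ (d₁ + d₂) := (hq n).trans
      ((Nat.pow_le_pow_left (by omega) _).trans (Nat.pow_le_pow_right (by omega) (by omega)))
    rw [Polynomial.eval_add, pow_succ]
    calc _ ≤ (n + (c₁ + c₂)) ^ (d₁ + d₂) * 2 := by omega
      _ ≤ _ := Nat.mul_le_mul_left _ (by omega)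

/-! ### Families of formulas that are instances of a template -/

/-- The words `g i` are the instances of a template. -/
def IsTemplate (g : ℕ → List Symb) : Prop :=
  ∃ w, ∀ i, instantiate (.bit true) w i = g i

theorem instantiate_map_some {B : Type} (u : B) (w : List B) (i : ℕ) :
    instantiate u (w.map some) i = w := by
  induction w with
  | nil => rfl
  | cons b w ih => simp_all [instantiate]

theorem IsTemplate.const (w : List Symb) : IsTemplate fun _ => w :=
  ⟨w.map some, instantiate_map_some _ w⟩

theorem IsTemplate.append {g h : ℕ → List Symb} (hg : IsTemplate g) (hh : IsTemplate h) :
    IsTemplate fun i => g i ++ h i := by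
  obtain ⟨v, hv⟩ := hg
  obtain ⟨w, hw⟩ := hh
  exact ⟨v ++ w, fun i => by simp [← hv, ← hw, instantiate]⟩

theorem IsTemplate.cons {g : ℕ → List Symb} (hg : IsTemplate g) (s : Symb) :
    IsTemplate fun i => s :: g i := (IsTemplate.const [s]).append hg

theorem IsTemplate.unary : IsTemplate fun i => List.replicate i (.bit true) :=
  ⟨[none], fun i => by simp [instantiate]⟩

theorem IsTemplate.flatMap {α : Type} {l : List α} {g : α → ℕ → List Symb}
    (h : ∀ a ∈ l, IsTemplate (g a)) : IsTemplate fun i => l.flatMap fun a => g a i := by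
  induction l with
  | nil => exact .const []
  | cons a l ih =>
    exact (h a List.mem_cons_self).append (ih fun b hb => h b (List.mem_cons_of_mem _ hb))

theorem IsTemplate.imp {l l' : ℕ → Literal} (h : IsTemplate fun i => (l i).encode)
    (h' : IsTemplate fun i => (l' i).encode) :
    IsTemplate fun i => (Formula.imp (l i) (l' i)).encode := by
  simp only [Formula.imp, Formula.encode, List.flatMap_singleton]
  exact (h.append (h'.cons _)).cons _

def encodeClauses (l : List Formula) : List Symb := l.flatMap fun ψ => .conj :: ψ.encode

theorem encode_conjs (l : List Formula) (φ : Formula) :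
    (Formula.conjs l φ).encode = encodeClauses l ++ φ.encode := by
  induction l with
  | nil => rfl
  | cons a l ih =>
    simp only [Formula.conjs, List.foldr_cons, Formula.encode, encodeClauses] at ih ⊢
    rw [ih]
    simp

theorem IsTemplate.clauses_nil : IsTemplate fun _ => encodeClauses [] := .const []

theorem IsTemplate.clauses_cons {F : ℕ → Formula} {G : ℕ → List Formula}
    (hF : IsTemplate fun i => (F i).encode) (hG : IsTemplate fun i => encodeClauses (G i)) :
    IsTemplate fun i => encodeClauses (F i :: G i) := (hF.cons .conj).append hG

theorem IsTemplate.clauses_append {F G : ℕ → List Formula}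
    (hF : IsTemplate fun i => encodeClauses (F i)) (hG : IsTemplate fun i => encodeClauses (G i)) :
    IsTemplate fun i => encodeClauses (F i ++ G i) := by
  simp only [encodeClauses, List.flatMap_append] at *
  exact hF.append hG

theorem IsTemplate.clauses_flatMap {α : Type} {l : List α} {G : α → ℕ → List Formula}
    (h : ∀ a ∈ l, IsTemplate fun i => encodeClauses (G a i)) :
    IsTemplate fun i => encodeClauses (l.flatMap fun a => G a i) := by
  simp only [encodeClauses, List.flatMap_assoc] at *
  exact .flatMap h

namespace TM

open IsTemplate

variable {A : Type} (M : TM A)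

theorem isTemplate_lit (v : M.Family) : IsTemplate fun i => (M.lit v i).encode := by
  simp only [lit, Literal.encode, name, List.map_append, List.map_replicate]
  exact (((IsTemplate.const _).append .unary).append (.const _)).cons _

theorem isTemplate_lit_succ (v : M.Family) : IsTemplate fun i => (M.lit v (i + 1)).encode := by
  simp only [lit, Literal.encode, name, List.map_append, List.replicate_succ, List.map_cons,
    List.map_replicate]
  exact (((IsTemplate.const _).append (IsTemplate.unary.cons _)).append (.const _)).cons _

theorem isTemplate_nextClause {v w : M.Family} {f g : ℕ → ℕ}
    (hf : IsTemplate fun i => (M.lit v (f i)).encode)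
    (hg : IsTemplate fun i => (M.lit w (g i)).encode) :
    IsTemplate fun i => (M.nextClause v (f i) w (g i)).encode :=
  .imp (hf.cons _) (hg.cons _)

theorem isTemplate_headClauses (c : Option M.Q) :
    IsTemplate fun i => encodeClauses (M.headClauses i c) := by
  have h := M.isTemplate_lit
  have h' := M.isTemplate_lit_succ
  cases c with
  | none =>
    exact clauses_cons (M.isTemplate_nextClause (h _) (h _)) <| clauses_cons (.imp (h _) (h' _)) <|
      clauses_cons (.imp (h _) (h _)) <| clauses_cons (.imp (h' _) (h _)) <|
      clauses_cons (.imp (h _) (h _)) clauses_nil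
  | some q =>
    simp only [headClauses]
    split_ifs
    · exact clauses_cons (.imp (h _) (.const _)) clauses_nil
    · exact clauses_nil
    · refine clauses_cons (M.isTemplate_nextClause (h _) (h _)) <| clauses_cons ?_ <|
        clauses_cons (.imp (h _) (h' _)) <| clauses_cons (.imp (h' _) (h _)) clauses_nil
      exact (((h _).append (.const _)).append (.const _)).cons _

theorem isTemplate_andClauses (c : Option M.Q) (s : M.S) :
    IsTemplate fun i => encodeClauses (M.andClauses i c s) := by
  have h := M.isTemplate_lit
  exact clauses_cons (.imp (h _) (h _)) <| clauses_cons (.imp (h _) ((h _).cons _)) <|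
    clauses_cons (.imp ((h _).cons _) ((h _).cons _)) clauses_nil

theorem isTemplate_resClauses (c : Option M.Q) (s : M.S) :
    IsTemplate fun i => encodeClauses (M.resClauses i c s) := by
  have h := M.isTemplate_lit
  have h' := M.isTemplate_lit_succ
  cases c with
  | none => exact clauses_cons (M.isTemplate_nextClause (h _) (h _)) clauses_nil
  | some q =>
    simp only [resClauses]
    split_ifs
    · exact clauses_nil
    · split
      · exact clauses_cons (M.isTemplate_nextClause (h _) (h _)) <|
          clauses_cons (M.isTemplate_nextClause (h _) (h _)) clauses_nil
      · exact clauses_cons (M.isTemplate_nextClause (h _) (h _)) <|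
          clauses_cons (M.isTemplate_nextClause (h' _) (h _)) clauses_nil
      · exact clauses_cons (M.isTemplate_nextClause (h _) (h _)) <|
          clauses_cons (M.isTemplate_nextClause (h _) (h' _)) clauses_nil

theorem isTemplate_block (s : M.S) : IsTemplate fun i => encodeClauses (M.block s i) :=
  clauses_cons (M.isTemplate_lit _) <| clauses_append
    (clauses_flatMap fun c _ => M.isTemplate_headClauses c)
    (clauses_flatMap fun c _ => clauses_append (M.isTemplate_andClauses c.1 c.2)
      (M.isTemplate_resClauses c.1 c.2))

/-- The formula for the computation on `x` is written by templates. -/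
theorem exists_encode_formula : ∃ blk base, ∀ x N,
    (M.formula (M.initial x).tape N).encode =
      Stack.blocks (.bit true) blk x N ++ instantiate (.bit true) base 0 := by
  choose w hw using M.isTemplate_block
  refine ⟨fun o : Option A => w (o.elim M.blank M.input),
    (encodeClauses M.baseClauses ++ [Symb.box .B, Symb.bot]).map some, fun x N => ?_⟩
  rw [instantiate_map_some, formula, encode_conjs]
  simp only [Stack.blocks, hw, encodeClauses, List.flatMap_append, List.flatMap_assoc,
    List.append_assoc]
  rfl

end TM

/-- The satisfiability problem is hard for every class of discrete orders in which there are
arbitrarily long finite chains of neighbouring points. -/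
theorem isPSpaceHard_coreBoxSat {C : Set LinOrd.{u}} (hC : ∀ T ∈ C, IsDiscreteOrder T)
    (hchain : ∀ m, ∃ T ∈ C, ∃ a : ℕ → T, ∀ k < m, a k ⋖ a (k + 1)) :
    IsPSpaceHard (coreBoxSat C) := by
  rintro A _ L ⟨M, p, hdec, hspace⟩
  obtain ⟨c, d, hc, hp⟩ := exists_eval_le_pow p
  obtain ⟨blk, base, henc⟩ := M.exists_encode_formula
  refine ⟨_, Stack.polyTime_blocks (u := Symb.bit true) (blk := blk) (base := base) (d := d) hc,
    fun x => ?_⟩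
  rw [← henc]
  constructor
  · intro hx
    obtain ⟨n, hn⟩ := (hdec x).1 hx
    obtain ⟨T, hT, a, ha⟩ := hchain (2 * n)
    exact ⟨_, M.formula_isBox _ _, M.formula_isCore _ _,
      ⟨T, hT, _, _, M.formula_sat (hC T hT).1 ha hn _⟩, rfl⟩
  · rintro ⟨φ, -, -, ⟨T, hT, ν, I, h⟩, hφ⟩
    by_contra hx
    rw [Formula.encode_injective hφ] at h
    refine M.formula_unsat (hC T hT).1 (fun n => ?_) ((hdec x).2 hx) h
    exact (hspace x n).trans_le ((hp _).trans (Nat.le_add_left _ _))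

end HSLogic

theorem mainTheorem6 :
    (∀ C : Set LinOrd.{u},
      (∀ T ∈ C, HSLogic.IsDiscreteOrder T) → (∃ T ∈ C, Infinite T) →
        HSLogic.IsPSpaceHard (HSLogic.coreBoxSat C)) ∧
    HSLogic.IsPSpaceHard (HSLogic.coreBoxSat {T : LinOrd.{u} | Finite T}) := by
  refine ⟨fun C hC ⟨T, hT, _⟩ => HSLogic.isPSpaceHard_coreBoxSat hC fun m =>
    ⟨T, hT, (hC T hT).exists_chain m⟩, ?_⟩
  refine HSLogic.isPSpaceHard_coreBoxSat (fun T (_ : Finite T) => ?_) fun m => ?_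
  · exact HSLogic.isDiscreteOrder_of_finite T
  · exact HSLogic.exists_finite_chain m
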